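/- A robust Markov chain (RMC) consists of a finite state set $S$ with $n=|S|$, a cost function $c\colon S\to\mathbb R$, a successor set $\operatorname{succ}(s)\subseteq S$ for each $s$, and a nonempty compact uncertainty set $\mathcal P(s)\subseteq\Delta(\operatorname{succ}(s))$ for each $s$. It has $L_p$ uncertainty if $\mathcal P(s)=\{q\in\Delta(\operatorname{succ}(s)) : \|q-\hat p_s\|_p\le\delta(s)\}$ for some nominal $\hat p_s\in\Delta(\operatorname{succ}(s))$ and radius $\delta(s)$. A (positional adversary) policy is a map $\tau$ with $\tau(s)\in\mathcal P(s)$ for all $s$; $P^\tau$ is the matrix with rows $\tau(s)$. For a discount factor $\gamma\in[0,1)$ the value is $v^*(s)=\sup_\tau \mathbb E^\tau_s\bigl[\sum_{t\ge0}\gamma^t c(s_t)\bigr]$, where $(s_t)$ is the Markov chain with transition matrix $P^\tau$ started in $s$; a policy is optimal if it attains $v^*(s)$ for every $s$. To solve an RMC means to compute $v^*$ and an optimal policy. Policy iteration (RMC-PI) starts from an arbitrary policy $\tau^0$ and computes, for $t=1,2,\dots$, the vector $v^{t-1}=(I-\gamma P^{\tau^{t-1}})^{-1}c$ and, for every $s$,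 some $\tau^t(s)\in\arg\max_{q\in\mathcal P(s)}\{c(s)+\gamma\,q^\top v^{t-1}\}$; it stops at the first $t\ge1$ with $\tau^t=\tau^{t-1}$ and returns $\tau^t$. Ties are broken consistently if $v^{t+1}=v^{t}$ always implies $\tau^{t+2}=\tau^{t+1}$ (for example, if the maximizer chosen is a function of $s$ and the vector $v$). **Theorem.** There is an absolute constant $C$ such that, for every RMC with $n\ge2$ states and $L_1$ or $L_\infty$ uncertainty and every $\gamma\in[0,1)$, with $$N=C\,n^3\log n\cdot\max\Bigl\{1,\ \frac{\log\frac{1-\gamma}{n}}{\log\gamma}\Bigr\}$$ (the quotient is read as $0$ if $\gamma=0$), the following hold for all policies $\tau^0,\tau^1,\dots$ generated by RMC-PI (continued beyond the stopping time): 1. If ties are broken consistently, RMC-PI stops after at most $N$ iterations, and the policy $\tau^T$ that it returns is optimal, with $(I-\gamma P^{\tau^T})^{-1}c=v^*$. 2. However ties are broken, $\tau^t$ is optimal and $v^t=v^*$ for every $t\ge N$. 3. Each iteration amounts to solving two RMCs with uncertainty of the same kind: $v^t$ is the value vector of the RMC with the same states and costs and uncertainty sets $\{\tau^t(s)\}$;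 and the policies $\tau'$ with $\tau'(s)\in\arg\max_{q\in\mathcal P(s)}\{c(s)+\gamma q^\top v^t\}$ for all $s$ are exactly the restrictions to $\{z_s\}$ of the optimal policies of the RMC with $2n$ states $z_s,x_s$ $(s\in S)$ in which $z_s$ has cost $c(s)$ and moves to the states $x_{s'}$ according to $\mathcal P(s)$, and $x_s$ is absorbing with cost $(1-\gamma)v^t(s)$. In particular, for a fixed $\gamma\in(0,1)$ and consistent tie-breaking, RMC-PI stops after $O\bigl(n^3\log n\cdot\log(\frac{1-\gamma}{n})/\log\gamma\bigr)$ iterations. -/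

import Mathlib

open MeasureTheory ProbabilityTheory
open scoped ENNReal

noncomputable section

/-- A robust Markov chain with finite state space `S`: a cost function, the possible successors of
each state and, for each state, a nonempty compact set of probability vectors supported on the
successors. -/
structure RMC (S : Type*) [Fintype S] where
  cost : S → ℝ
  succ : S → Set S
  uncertainty : S → Set (stdSimplex ℝ S)
  supported : ∀ s, ∀ q ∈ uncertainty s, ∀ s' ∉ succ s, q s' = 0
  isCompact : ∀ s, IsCompact (uncertainty s)
  nonempty : ∀ s, (uncertainty s).Nonempty

/-- The probability measure on `S` given by a probability vector. -/
def stepMeasure {S : Type*} [Fintype S] [MeasurableSpace S] (q : stdSimplex ℝ S) : Measure S :=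
  ∑ s, ENNReal.ofReal (q s) • Measure.dirac s

instance {S : Type*} [Fintype S] [MeasurableSpace S] (q : stdSimplex ℝ S) :
    IsProbabilityMeasure (stepMeasure q) := by
  constructor
  simp only [stepMeasure, Measure.coe_finsetSum, Finset.sum_apply, Measure.smul_apply,
    measure_univ, smul_eq_mul, mul_one]
  rw [← ENNReal.ofReal_sum_of_nonneg (fun s _ => stdSimplex.zero_le q s)]
  simp

/-- The transition kernel: given the history `s₀, …, s_t`, the next state has law `τ s_t`. -/
def stepKernel {S : Type*} [Fintype S] [MeasurableSpace S] [DiscreteMeasurableSpace S]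
    (τ : S → stdSimplex ℝ S) (t : ℕ) : Kernel (Finset.Iic t → S) S where
  toFun h := stepMeasure (τ (h ⟨t, Finset.mem_Iic.2 le_rfl⟩))
  measurable' := (Measurable.of_discrete (f := fun s => stepMeasure (τ s))).comp
    (measurable_pi_apply _)

instance {S : Type*} [Fintype S] [MeasurableSpace S] [DiscreteMeasurableSpace S]
    (τ : S → stdSimplex ℝ S) (t : ℕ) : IsMarkovKernel (stepKernel τ t) :=
  ⟨fun h => inferInstanceAs
    (IsProbabilityMeasure (stepMeasure (τ (h ⟨t, Finset.mem_Iic.2 le_rfl⟩))))⟩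

/-- The probability measure on runs `ℕ → S` started in `s₀` when the transition vectors are `τ`. -/
def runMeasure {S : Type*} [Fintype S] [MeasurableSpace S] [DiscreteMeasurableSpace S]
    (τ : S → stdSimplex ℝ S) (s₀ : S) : Measure (ℕ → S) :=
  Kernel.traj (X := fun _ => S) (stepKernel τ) 0 (fun _ => s₀)

/-- The expected discounted cost `E_{s₀} [∑ₜ γ ^ t * c (sₜ)]`; `S` carries the discrete
sigma-algebra. -/
def expectedCost {S : Type*} [Fintype S] (γ : ℝ) (c : S → ℝ) (τ : S → stdSimplex ℝ S)
    (s₀ : S) : ℝ :=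
  letI : MeasurableSpace S := ⊤
  haveI : DiscreteMeasurableSpace S := ⟨fun _ => trivial⟩
  ∫ ω, ∑' t : ℕ, γ ^ t * c (ω t) ∂(runMeasure τ s₀)

namespace RMC

variable {S : Type*} [Fintype S]

/-- The uncertainty sets are `L_p` balls of probability vectors around a nominal transition
function, within the probability vectors supported on the successors. -/
def HasLpUncertainty (M : RMC S) (p : ℝ≥0∞) : Prop :=
  ∃ (nominal : S → stdSimplex ℝ S) (δ : S → ℝ),
    (∀ s, ∀ s' ∉ M.succ s, nominal s s' = 0) ∧
    ∀ s, M.uncertainty s = {q | (∀ s' ∉ M.succ s, q s' = 0) ∧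
      ‖(WithLp.toLp p (fun s' => q s' - nominal s s') : PiLp p fun _ : S => ℝ)‖ ≤ δ s}

/-- Positional adversary policies. -/
def IsPolicy (M : RMC S) (τ : S → stdSimplex ℝ S) : Prop :=
  ∀ s, τ s ∈ M.uncertainty s

/-- The value vector: the adversary maximizes the expected discounted cost. -/
def value (M : RMC S) (γ : ℝ) (s : S) : ℝ :=
  ⨆ τ : {τ : S → stdSimplex ℝ S // M.IsPolicy τ}, expectedCost γ M.cost τ.1 s

/-- A policy is optimal if it attains the value in every state. -/
def IsOptimal (M : RMC S) (γ : ℝ) (τ : S → stdSimplex ℝ S) : Prop :=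
  M.IsPolicy τ ∧ ∀ s, expectedCost γ M.cost τ s = M.value γ s

/-- Policy evaluation, `(I - γ P^τ)⁻¹ c`. -/
def policyEval [DecidableEq S] (M : RMC S) (γ : ℝ) (τ : S → stdSimplex ℝ S) : S → ℝ :=
  ((1 : Matrix S S ℝ) - γ • Matrix.of fun s s' => τ s s')⁻¹.mulVec M.cost

/-- Policy improvement: `τ'` maximizes `c s + γ * q ⬝ v` over the uncertainty set of every
state `s`. -/
def IsImprovement (M : RMC S) (γ : ℝ) (v : S → ℝ) (τ' : S → stdSimplex ℝ S) : Prop :=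
  ∀ s, τ' s ∈ M.uncertainty s ∧
    ∀ q ∈ M.uncertainty s,
      M.cost s + γ * ∑ s', q s' * v s' ≤ M.cost s + γ * ∑ s', τ' s s' * v s'

/-- The policies produced by policy iteration from an arbitrary initial policy, with arbitrary
choices among the maximizers. The stopping test is not part of this predicate. -/
def IsPolicyIteration [DecidableEq S] (M : RMC S) (γ : ℝ) (τ : ℕ → S → stdSimplex ℝ S) : Prop :=
  M.IsPolicy (τ 0) ∧ ∀ t, M.IsImprovement γ (M.policyEval γ (τ t)) (τ (t + 1))

/-- Ties among maximizers are broken consistently: if the value vector has not changed, then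
neither does the chosen maximizer. This holds if the maximizer is a function of the state and the
value vector, and also if the current choice is kept whenever it is still a maximizer. -/
def ConsistentTies [DecidableEq S] (M : RMC S) (γ : ℝ) (τ : ℕ → S → stdSimplex ℝ S) : Prop :=
  ∀ t, M.policyEval γ (τ (t + 1)) = M.policyEval γ (τ t) → τ (t + 2) = τ (t + 1)

/-- The number of iterations after which the loop `repeat … until τ t = τ (t - 1)` stops. -/
def StopsAt (τ : ℕ → S → stdSimplex ℝ S) (T : ℕ) : Prop :=
  IsLeast {t | 1 ≤ t ∧ τ t = τ (t - 1)} T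

/-- A Markov chain as a robust Markov chain with singleton uncertainty sets. -/
def ofChain (c : S → ℝ) (P : S → stdSimplex ℝ S) : RMC S where
  cost := c
  succ s := {s' | P s s' ≠ 0}
  uncertainty s := {P s}
  supported := by
    intro s q hq s' hs'
    rw [Set.mem_singleton_iff.1 hq]
    simpa using hs'
  isCompact _ := isCompact_singleton
  nonempty _ := Set.singleton_nonempty _

/-- The batch robust Markov chain of a vector `v`. The transient copy `inl s` of a state `s` has
the cost of `s` and moves to the copies `inr s'` according to the uncertainty set of `s`; the copy
`inr s` is absorbing with cost `(1 - γ) * v s`. -/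
def batch [DecidableEq S] (M : RMC S) (γ : ℝ) (v : S → ℝ) : RMC (S ⊕ S) where
  cost := Sum.elim M.cost fun s => (1 - γ) * v s
  succ := Sum.elim (fun s => Sum.inr '' M.succ s) fun s => {Sum.inr s}
  uncertainty := Sum.elim (fun s => stdSimplex.map Sum.inr '' M.uncertainty s)
    fun s => {stdSimplex.vertex (Sum.inr s)}
  supported := by
    rintro (s | s) q hq s' hs'
    · obtain ⟨r, hr, rfl⟩ := hq
      rw [stdSimplex.map_coe, FunOnFinite.linearMap_apply_apply]
      refine Finset.sum_eq_zero fun x hx => ?_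
      refine M.supported s r hr x fun hxs => hs' ?_
      exact ⟨x, hxs, (Finset.mem_filter.1 hx).2⟩
    · rw [Set.mem_singleton_iff.1 hq]
      have : s' ≠ Sum.inr s := hs'
      simp [this]
  isCompact := by
    rintro (s | s)
    · exact (M.isCompact s).image (stdSimplex.continuous_map _)
    · exact isCompact_singleton
  nonempty := by
    rintro (s | s)
    · exact (M.nonempty s).image _
    · exact Set.singleton_nonempty _

end RMC

end

/-! ### Averages under probability vectors and the discounted maximum principle -/

section StochasticMatrix

variable {S : Type*} [Fintype S]

/-! Progress is measured by a regret `y t`: the largest one-step loss, with respect to the optimal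
value `v`, over chosen vertices of the uncertainty sets that are greedy for the evaluation of `τ t`.
By `exists_regret` it is at most `γ` times the current error, and the next error is at most `y t /
(1 - γ)`. Since errors contract by `γ` per iteration, the regret halves every `L` iterations as soon
as `2 * γ ^ L ≤ 1 - γ`.

Geometric decay alone gives no finite bound; the shape of the balls does. All but one coordinate of
a vertex of an L1 or L∞ ball are 0, nominal, or nominal shifted by a fixed amount, and the last is
determined by total mass 1. So the regret at a state is a combination, with integer coefficients at
most `n + 1` in absolute value, of `(n + 1) ^ 2` reals depending only on that state
(`IsBasicPoint.exists_coeff`). Positive halving sequences have distinct subset sums, whereas small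
integer combinations of few reals take few values; counting (`two_pow_card_le_of_halving`) leaves
each state only O(n² log n) halvings. After n times as many, the regret vanishes and the value is
reached.

Consistent ties then force a repeated policy. Conversely a repeated policy is greedy for its own
evaluation, hence optimal. -/

lemma stdSimplex.sum_mul_le {q : stdSimplex ℝ S} {x : S → ℝ} {a : ℝ} (h : ∀ s, x s ≤ a) :
    ∑ s, q s * x s ≤ a :=
  calc ∑ s, q s * x s ≤ ∑ s, q s * a :=
        Finset.sum_le_sum fun s _ => mul_le_mul_of_nonneg_left (h s) (stdSimplex.zero_le q s)
    _ = a := by rw [← Finset.sum_mul, stdSimplex.sum_eq_one, one_mul]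

lemma stdSimplex.sum_mul_le_sum_mul (q : stdSimplex ℝ S) {x y : S → ℝ} (h : ∀ s, x s ≤ y s) :
    ∑ s, q s * x s ≤ ∑ s, q s * y s :=
  Finset.sum_le_sum fun s _ => mul_le_mul_of_nonneg_left (h s) (stdSimplex.zero_le q s)

lemma stdSimplex.sum_mul_sub (q : stdSimplex ℝ S) (x y : S → ℝ) :
    ∑ s, q s * (x s - y s) = ∑ s, q s * x s - ∑ s, q s * y s := by
  simp only [mul_sub, Finset.sum_sub_distrib]

/-- Discounted maximum principle. -/
lemma le_div_of_le_add_discounted {γ : ℝ} (h0 : 0 ≤ γ) (h1 : γ < 1) (τ : S → stdSimplex ℝ S)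
    {x : S → ℝ} {a : ℝ} (h : ∀ s, x s ≤ a + γ * ∑ s', τ s s' * x s') (s : S) :
    x s ≤ a / (1 - γ) := by
  have : Nonempty S := ⟨s⟩
  obtain ⟨m, hm⟩ := Finite.exists_max x
  have h2 : ∑ s', τ m s' * x s' ≤ x m := stdSimplex.sum_mul_le hm
  have h3 := mul_le_mul_of_nonneg_left h2 h0
  rw [le_div_iff₀ (by linarith)]
  nlinarith [h m, hm s]

lemma nonpos_of_le_discounted {γ : ℝ} (h0 : 0 ≤ γ) (h1 : γ < 1) (τ : S → stdSimplex ℝ S)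
    {x : S → ℝ} (h : ∀ s, x s ≤ γ * ∑ s', τ s s' * x s') (s : S) : x s ≤ 0 := by
  simpa using le_div_of_le_add_discounted h0 h1 τ (a := 0) (by simpa using h) s

end StochasticMatrix

/-! ### Policy evaluation and the Bellman equation -/

namespace RMC

variable {S : Type*} [Fintype S]

section Evaluation

variable [DecidableEq S] (M : RMC S) {γ : ℝ} (h0 : 0 ≤ γ) (h1 : γ < 1)
  (τ : S → stdSimplex ℝ S)

include h0 h1 in
-- Strict diagonal dominance: in row `k` the off-diagonal entries sum to `γ * (1 - τ k k)`, less
-- than `1 - γ * τ k k`.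
lemma det_one_sub_smul_ne_zero :
    ((1 : Matrix S S ℝ) - γ • Matrix.of fun s s' => τ s s').det ≠ 0 := by
  refine det_ne_zero_of_sum_row_lt_diag fun k => ?_
  have hk : 0 ≤ τ k k := stdSimplex.zero_le _ _
  have hk1 : τ k k ≤ 1 := stdSimplex.le_one _ _
  have hs : ∑ j ∈ Finset.univ.erase k, τ k j = 1 - τ k k := by
    rw [← stdSimplex.sum_eq_one (τ k), ← Finset.add_sum_erase _ _ (Finset.mem_univ k)]
    ring
  have : ∑ j ∈ Finset.univ.erase k,
      ‖((1 : Matrix S S ℝ) - γ • Matrix.of fun s s' => τ s s') k j‖ = γ * (1 - τ k k) := by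
    rw [← hs, Finset.mul_sum]
    refine Finset.sum_congr rfl fun j hj => ?_
    have hjk : k ≠ j := (Finset.ne_of_mem_erase hj).symm
    simp [Matrix.one_apply_ne hjk, abs_of_nonneg h0, abs_of_nonneg (stdSimplex.zero_le (τ k) j)]
  rw [this]
  simp only [Matrix.sub_apply, Matrix.one_apply_eq, Matrix.smul_apply, Matrix.of_apply,
    smul_eq_mul, Real.norm_eq_abs]
  refine lt_of_lt_of_le ?_ (le_abs_self _)
  nlinarith

include h0 h1 in
lemma policyEval_apply (s : S) :
    M.policyEval γ τ s = M.cost s + γ * ∑ s', τ s s' * M.policyEval γ τ s' := by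
  set A : Matrix S S ℝ := (1 : Matrix S S ℝ) - γ • Matrix.of fun s s' => τ s s' with hA
  have hu : IsUnit A.det := (det_one_sub_smul_ne_zero h0 h1 τ).isUnit
  have h : A.mulVec (M.policyEval γ τ) = M.cost := by
    rw [policyEval, ← hA, Matrix.mulVec_mulVec, Matrix.mul_nonsing_inv _ hu, Matrix.one_mulVec]
  have hs := congrFun h s
  rw [hA, Matrix.sub_mulVec, Matrix.one_mulVec, Matrix.smul_mulVec] at hs
  simp only [Pi.sub_apply, Pi.smul_apply, smul_eq_mul, Matrix.mulVec, dotProduct,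
    Matrix.of_apply] at hs
  linarith

include h0 h1 in
-- The costs cancel in the difference with the evaluation equation, and the maximum principle
-- applies.
lemma policyEval_le_of_supersolution {x : S → ℝ}
    (h : ∀ s, M.cost s + γ * ∑ s', τ s s' * x s' ≤ x s) (s : S) : M.policyEval γ τ s ≤ x s := by
  have := nonpos_of_le_discounted h0 h1 τ (x := fun s => M.policyEval γ τ s - x s) (fun s => by
    rw [stdSimplex.sum_mul_sub]
    have := M.policyEval_apply h0 h1 τ s
    linarith [h s]) s
  simpa using this

include h0 h1 in
lemma le_policyEval_of_subsolution {x : S → ℝ}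
    (h : ∀ s, x s ≤ M.cost s + γ * ∑ s', τ s s' * x s') (s : S) : x s ≤ M.policyEval γ τ s := by
  have := nonpos_of_le_discounted h0 h1 τ (x := fun s => x s - M.policyEval γ τ s) (fun s => by
    rw [stdSimplex.sum_mul_sub]
    have := M.policyEval_apply h0 h1 τ s
    linarith [h s]) s
  simpa using this

include h0 h1 in
lemma eq_policyEval {x : S → ℝ}
    (h : ∀ s, x s = M.cost s + γ * ∑ s', τ s s' * x s') : x = M.policyEval γ τ :=
  funext fun s => le_antisymm (M.le_policyEval_of_subsolution h0 h1 τ (fun s => (h s).le) s)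
    (M.policyEval_le_of_supersolution h0 h1 τ (fun s => (h s).ge) s)

end Evaluation

section Bellman

lemma continuous_sum_mul (v : S → ℝ) : Continuous fun q : stdSimplex ℝ S => ∑ s, q s * v s :=
  continuous_finsetSum _ fun s _ =>
    ((continuous_apply s).comp continuous_subtype_val).mul continuous_const

lemma exists_greedy (M : RMC S) (v : S → ℝ) (s : S) :
    ∃ q ∈ M.uncertainty s, ∀ r ∈ M.uncertainty s, ∑ s', r s' * v s' ≤ ∑ s', q s' * v s' :=
  (M.isCompact s).exists_isMaxOn (M.nonempty s) (continuous_sum_mul v).continuousOn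

/-- The vector `v` satisfies the Bellman equation and `τ` is greedy for it. -/
def IsBellmanSolution (M : RMC S) (γ : ℝ) (v : S → ℝ) (τ : S → stdSimplex ℝ S) : Prop :=
  (∀ s, v s = M.cost s + γ * ∑ s', τ s s' * v s') ∧
  ∀ s, τ s ∈ M.uncertainty s ∧
    ∀ q ∈ M.uncertainty s, ∑ s', q s' * v s' ≤ ∑ s', τ s s' * v s'

/-- The Bellman operator, with its maxima attained by compactness, is a `γ`-contraction in the sup
distance; its fixed point is the solution. -/
lemma exists_isBellmanSolution (M : RMC S) {γ : ℝ} (h0 : 0 ≤ γ) (h1 : γ < 1) :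
    ∃ v τ, M.IsBellmanSolution γ v τ := by
  choose g hg hmax using M.exists_greedy
  let T : (S → ℝ) → S → ℝ := fun v s => M.cost s + γ * ∑ s', g v s s' * v s'
  have key : ∀ v w s, T v s - T w s ≤ γ * dist v w := by
    intro v w s
    -- Both maxima are compared through the single row `g v s`: it attains the one for `v` and is a
    -- competitor in the one for `w`.
    have e1 := hmax w s (g v s) (hg v s)
    have e2 : ∑ s', g v s s' * (v s' - w s') ≤ dist v w :=
      stdSimplex.sum_mul_le fun s' => (le_abs_self _).trans (dist_le_pi_dist v w s')
    rw [stdSimplex.sum_mul_sub] at e2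
    have e3 : ∑ s', g v s s' * v s' - ∑ s', g w s s' * w s' ≤ dist v w := by linarith
    have := mul_le_mul_of_nonneg_left e3 h0
    simp only [T]
    linarith
  have hT : ContractingWith ⟨γ, h0⟩ T := by
    refine ⟨by exact_mod_cast h1, LipschitzWith.of_dist_le_mul fun v w => ?_⟩
    refine (dist_pi_le_iff (by positivity)).2 fun s => ?_
    rw [Real.dist_eq]
    refine abs_sub_le_iff.2 ⟨key v w s, ?_⟩
    rw [dist_comm v w]
    exact key w v s
  have hfix : T (hT.fixedPoint T) = hT.fixedPoint T := hT.fixedPoint_isFixedPt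
  exact ⟨hT.fixedPoint T, g (hT.fixedPoint T), fun s => (congrFun hfix s).symm,
    fun s => ⟨hg _ s, fun q hq => hmax _ s q hq⟩⟩

lemma IsBellmanSolution.policyEval_le [DecidableEq S] {M : RMC S} {γ : ℝ} (h0 : 0 ≤ γ)
    (h1 : γ < 1) {v : S → ℝ} {τ : S → stdSimplex ℝ S} (h : M.IsBellmanSolution γ v τ)
    {σ : S → stdSimplex ℝ S} (hσ : M.IsPolicy σ) (s : S) : M.policyEval γ σ s ≤ v s :=
  M.policyEval_le_of_supersolution h0 h1 σ (fun s => by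
    rw [h.1 s]
    have := mul_le_mul_of_nonneg_left ((h.2 s).2 _ (hσ s)) h0
    linarith) s

end Bellman

end RMC

/-! ### Expected discounted cost along runs -/

section RunMeasure

variable {S : Type*} [Fintype S] [MeasurableSpace S] [DiscreteMeasurableSpace S]

lemma integral_stepMeasure (q : stdSimplex ℝ S) (f : S → ℝ) :
    ∫ s, f s ∂stepMeasure q = ∑ s, q s * f s := by
  rw [stepMeasure, integral_finsetSum_measure]
  · refine Finset.sum_congr rfl fun s _ => ?_
    rw [integral_smul_measure, integral_dirac, ENNReal.toReal_ofReal (stdSimplex.zero_le q s),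
      smul_eq_mul]
  · intro s _
    exact (integrable_dirac (by simp)).smul_measure ENNReal.ofReal_ne_top

instance (τ : S → stdSimplex ℝ S) (s₀ : S) : IsProbabilityMeasure (runMeasure τ s₀) := by
  unfold runMeasure
  infer_instance

variable (τ : S → stdSimplex ℝ S) (s₀ : S)

lemma integrable_comp_eval (f : S → ℝ) (t : ℕ) :
    Integrable (fun ω : ℕ → S => f (ω t)) (runMeasure τ s₀) := by
  obtain ⟨b, hb⟩ := (Set.finite_range fun s => ‖f s‖).bddAbove
  refine Integrable.of_bound (C := b) ?_ (Filter.Eventually.of_forall fun ω => hb ⟨ω t, rfl⟩)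
  exact ((Measurable.of_discrete (f := f)).comp (measurable_pi_apply t)).aestronglyMeasurable

lemma integral_eval_zero (f : S → ℝ) : ∫ ω, f (ω 0) ∂runMeasure τ s₀ = f s₀ := by
  rw [runMeasure, Kernel.integral_traj]
  · simp [Function.updateFinset]
  · exact (integrable_comp_eval τ s₀ f 0).aestronglyMeasurable

/-- The Markov property: condition on the history up to time `t`. -/
lemma integral_eval_succ (f : S → ℝ) (t : ℕ) :
    ∫ ω, f (ω (t + 1)) ∂runMeasure τ s₀ =
      ∫ ω, ∑ s', τ (ω t) s' * f s' ∂runMeasure τ s₀ := by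
  have hint := integrable_comp_eval τ s₀ f (t + 1)
  unfold runMeasure at hint ⊢
  rw [← Kernel.integral_traj_partialTraj (Nat.zero_le t) hint]
  have inner : ∀ x : (Finset.Iic t → S),
      ∫ y, f (y (t + 1)) ∂Kernel.traj (X := fun _ => S) (stepKernel τ) t x =
        ∑ s', τ (x ⟨t, Finset.mem_Iic.2 le_rfl⟩) s' * f s' := by
    intro x
    rw [← integral_stepMeasure]
    change _ = ∫ s, f s ∂(stepKernel τ t x)
    rw [← Kernel.map_traj_succ_self (X := fun _ => S) (κ := stepKernel τ),
      Kernel.map_apply _ (measurable_pi_apply _),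
      integral_map (measurable_pi_apply _).aemeasurable
        (Measurable.of_discrete (f := f)).aestronglyMeasurable]
  simp_rw [inner]
  rw [← Kernel.traj_map_frestrictLe_apply, integral_map]
  · rfl
  · exact (Preorder.measurable_frestrictLe t).aemeasurable
  · exact ((Measurable.of_discrete
      (f := fun s : S => ∑ s', τ s s' * f s')).comp (measurable_pi_apply _)).aestronglyMeasurable

lemma abs_integral_eval_le {f : S → ℝ} {b : ℝ} (hb : ∀ s, |f s| ≤ b) (t : ℕ) :
    |∫ ω, f (ω t) ∂runMeasure τ s₀| ≤ b := by
  have := norm_integral_le_of_norm_le_const (μ := runMeasure τ s₀)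
    (f := fun ω : ℕ → S => f (ω t)) (C := b) (Filter.Eventually.of_forall fun ω => hb _)
  simpa using this

/-- Writing `c = v - γ P v` makes the expected series telescope, and `γ ^ n` kills the bounded
remainder. -/
lemma integral_tsum_discounted {γ : ℝ} (h0 : 0 ≤ γ) (h1 : γ < 1) {c v : S → ℝ}
    (h : ∀ s, v s = c s + γ * ∑ s', τ s s' * v s') :
    ∫ ω, ∑' t : ℕ, γ ^ t * c (ω t) ∂runMeasure τ s₀ = v s₀ := by
  obtain ⟨b, hb⟩ := (Set.finite_range fun s => |c s|).bddAbove
  obtain ⟨d, hd⟩ := (Set.finite_range fun s => |v s|).bddAbove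
  have hb' : ∀ s, |c s| ≤ b := fun s => hb ⟨s, rfl⟩
  have hd' : ∀ s, |v s| ≤ d := fun s => hd ⟨s, rfl⟩
  have hgeo := (summable_geometric_of_lt_one h0 h1).mul_right b
  have hsum := hasSum_integral_of_summable_integral_norm (μ := runMeasure τ s₀)
    (F := fun t (ω : ℕ → S) => γ ^ t * c (ω t))
    (fun t => (integrable_comp_eval τ s₀ c t).const_mul _) (by
      refine Summable.of_nonneg_of_le (fun t => by positivity) (fun t => ?_) hgeo
      have := abs_integral_eval_le τ s₀ (f := fun s => |c s|) (b := b) (by simpa using hb') t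
      simp only [norm_mul, norm_pow, Real.norm_eq_abs, abs_of_nonneg h0]
      rw [integral_const_mul]
      exact mul_le_mul_of_nonneg_left ((le_abs_self _).trans this) (by positivity))
  let a : ℕ → ℝ := fun t => ∫ ω, v (ω t) ∂runMeasure τ s₀
  have hterm : ∀ t, ∫ ω, γ ^ t * c (ω t) ∂runMeasure τ s₀ =
      γ ^ t * a t - γ ^ (t + 1) * a (t + 1) := by
    intro t
    have hc : ∀ ω : ℕ → S, c (ω t) = v (ω t) - γ * ∑ s', τ (ω t) s' * v s' := fun ω => by
      rw [h (ω t)]; ring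
    simp_rw [hc]
    rw [integral_const_mul, integral_sub (integrable_comp_eval τ s₀ v t)
      ((integrable_comp_eval τ s₀ (fun s => ∑ s', τ s s' * v s') t).const_mul γ),
      integral_const_mul, ← integral_eval_succ]
    simp only [a]
    ring
  have hpart : ∀ n, ∑ t ∈ Finset.range n, ∫ ω, γ ^ t * c (ω t) ∂runMeasure τ s₀ =
      a 0 - γ ^ n * a n := by
    intro n
    simp_rw [hterm]
    rw [Finset.sum_range_sub' (fun t => γ ^ t * a t)]
    simp
  have hlim : Filter.Tendsto (fun n => a 0 - γ ^ n * a n) Filter.atTop (nhds (a 0 - 0)) := by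
    refine tendsto_const_nhds.sub ?_
    refine squeeze_zero_norm (a := fun n => γ ^ n * d) (fun n => ?_) ?_
    · rw [norm_mul, norm_pow, Real.norm_eq_abs, Real.norm_eq_abs, abs_of_nonneg h0]
      exact mul_le_mul_of_nonneg_left (abs_integral_eval_le τ s₀ hd' n) (by positivity)
    · simpa using (tendsto_pow_atTop_nhds_zero_of_lt_one h0 h1).mul_const d
  have h2 := hsum.tendsto_sum_nat
  simp_rw [hpart] at h2
  rw [tendsto_nhds_unique h2 hlim, sub_zero]
  exact integral_eval_zero τ s₀ v

end RunMeasure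

/-! ### Values and optimal policies -/

namespace RMC

variable {S : Type*} [Fintype S] [DecidableEq S] (M : RMC S) {γ : ℝ}

lemma expectedCost_eq_policyEval (h0 : 0 ≤ γ) (h1 : γ < 1) (τ : S → stdSimplex ℝ S) :
    expectedCost γ M.cost τ = M.policyEval γ τ := by
  funext s
  let _ : MeasurableSpace S := ⊤
  have : DiscreteMeasurableSpace S := ⟨fun _ => trivial⟩
  exact integral_tsum_discounted τ s h0 h1 (M.policyEval_apply h0 h1 τ)

lemma IsBellmanSolution.eq_value {M : RMC S} (h0 : 0 ≤ γ) (h1 : γ < 1) {v : S → ℝ}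
    {τ : S → stdSimplex ℝ S} (h : M.IsBellmanSolution γ v τ) : M.value γ = v := by
  funext s
  have hτ : M.IsPolicy τ := fun s => (h.2 s).1
  have hb : ∀ σ : {σ : S → stdSimplex ℝ S // M.IsPolicy σ},
      expectedCost γ M.cost σ.1 s ≤ v s := fun σ => by
    rw [M.expectedCost_eq_policyEval h0 h1]
    exact h.policyEval_le h0 h1 σ.2 s
  have : Nonempty {σ : S → stdSimplex ℝ S // M.IsPolicy σ} := ⟨⟨τ, hτ⟩⟩
  refine le_antisymm (ciSup_le hb) ?_
  calc v s = expectedCost γ M.cost τ s := by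
        rw [M.expectedCost_eq_policyEval h0 h1, ← M.eq_policyEval h0 h1 τ h.1]
    _ ≤ M.value γ s := le_ciSup (f := fun σ : {σ : S → stdSimplex ℝ S // M.IsPolicy σ} =>
        expectedCost γ M.cost σ.1 s) ⟨v s, by rintro _ ⟨σ, rfl⟩; exact hb σ⟩ ⟨τ, hτ⟩

lemma policyEval_le_value (h0 : 0 ≤ γ) (h1 : γ < 1) {σ : S → stdSimplex ℝ S}
    (hσ : M.IsPolicy σ) (s : S) : M.policyEval γ σ s ≤ M.value γ s := by
  obtain ⟨v, τ, h⟩ := M.exists_isBellmanSolution h0 h1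
  rw [h.eq_value h0 h1]
  exact h.policyEval_le h0 h1 hσ s

lemma isOptimal_iff_policyEval_eq (h0 : 0 ≤ γ) (h1 : γ < 1) {σ : S → stdSimplex ℝ S} :
    M.IsOptimal γ σ ↔ M.IsPolicy σ ∧ M.policyEval γ σ = M.value γ := by
  rw [IsOptimal, M.expectedCost_eq_policyEval h0 h1, funext_iff]

/-- A policy that is greedy for its own evaluation is optimal. -/
lemma policyEval_eq_value_of_isImprovement (h0 : 0 ≤ γ) (h1 : γ < 1)
    {τ : S → stdSimplex ℝ S} (h : M.IsImprovement γ (M.policyEval γ τ) τ) :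
    M.policyEval γ τ = M.value γ := by
  refine funext fun s => le_antisymm (M.policyEval_le_value h0 h1 (fun s => (h s).1) s) ?_
  obtain ⟨v, σ, hv⟩ := M.exists_isBellmanSolution h0 h1
  rw [hv.eq_value h0 h1, M.eq_policyEval h0 h1 σ hv.1]
  refine M.policyEval_le_of_supersolution h0 h1 σ (fun s => ?_) s
  rw [M.policyEval_apply h0 h1 τ s]
  exact (h s).2 _ (hv.2 s).1

end RMC

/-! ### Subset sums of halving sequences -/

section Halving

variable {y : ℕ → ℝ}

/-- The extra copy of the last term drives the induction, and makes a positive tail strictly smaller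
than `y j`. -/
lemma sum_Ico_add_le_of_halving (h : ∀ j, 2 * y (j + 1) ≤ y j) (j d : ℕ) :
    ∑ i ∈ Finset.Ico (j + 1) (j + 1 + d), y i + y (j + d) ≤ y j := by
  induction d with
  | zero => simp
  | succ d ih =>
    rw [← Nat.add_assoc, Finset.sum_Ico_succ_top (by lia)]
    have := h (j + d)
    rw [show j + 1 + d = j + d + 1 by ring, show j + (d + 1) = j + d + 1 by ring] at *
    linarith

/-- After cancelling the common part, the single term `y j` outweighs everything on the other side.
-/
lemma sum_ne_sum_of_halving {m : ℕ} (hpos : ∀ j < m, 0 < y j) (h : ∀ j, 2 * y (j + 1) ≤ y j)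
    {A B : Finset ℕ} (hA : A ⊆ Finset.range m) (hB : B ⊆ Finset.range m) {j : ℕ}
    (hjA : j ∈ A \ B) (hj : ∀ i ∈ B \ A, j < i) : ∑ i ∈ A, y i ≠ ∑ i ∈ B, y i := by
  intro heq
  have hd : ∑ i ∈ A \ B, y i = ∑ i ∈ B \ A, y i := by
    have e1 := Finset.sum_inter_add_sum_sdiff A B y
    have e2 := Finset.sum_inter_add_sum_sdiff B A y
    rw [Finset.inter_comm] at e2
    linarith
  have hjm : j < m := Finset.mem_range.1 (hA (Finset.mem_sdiff.1 hjA).1)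
  have h1 : y j ≤ ∑ i ∈ A \ B, y i :=
    Finset.single_le_sum (f := y)
      (fun i hi => (hpos i (Finset.mem_range.1 (hA (Finset.mem_sdiff.1 hi).1))).le) hjA
  have h2 : ∑ i ∈ B \ A, y i ≤ ∑ i ∈ Finset.Ico (j + 1) (j + 1 + (m - 1 - j)), y i := by
    refine Finset.sum_le_sum_of_subset_of_nonneg (fun i hi => ?_) fun i hi _ => ?_
    · have := hj i hi
      have := Finset.mem_range.1 (hB (Finset.mem_sdiff.1 hi).1)
      rw [Finset.mem_Ico]
      lia
    · rw [Finset.mem_Ico] at hi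
      exact (hpos i (by lia)).le
  have h3 := sum_Ico_add_le_of_halving h j (m - 1 - j)
  have h4 := hpos (j + (m - 1 - j)) (by lia)
  linarith

lemma eq_of_sum_eq_of_halving {m : ℕ} (hpos : ∀ j < m, 0 < y j) (h : ∀ j, 2 * y (j + 1) ≤ y j)
    {A B : Finset ℕ} (hA : A ⊆ Finset.range m) (hB : B ⊆ Finset.range m)
    (heq : ∑ i ∈ A, y i = ∑ i ∈ B, y i) : A = B := by
  by_contra hne
  have hD : (symmDiff A B).Nonempty := Finset.nonempty_iff_ne_empty.2 fun h => hne (by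
    rwa [← Finset.bot_eq_empty, symmDiff_eq_bot] at h)
  have hmin : ∀ i ∈ symmDiff A B, (symmDiff A B).min' hD ≤ i := fun i hi => Finset.min'_le _ i hi
  have hmem := Finset.min'_mem _ hD
  set j := (symmDiff A B).min' hD
  rcases Finset.mem_symmDiff.1 hmem with ⟨h1, h2⟩ | ⟨h1, h2⟩
  · refine sum_ne_sum_of_halving hpos h hA hB (Finset.mem_sdiff.2 ⟨h1, h2⟩) (fun i hi => ?_) heq
    obtain ⟨hi1, hi2⟩ := Finset.mem_sdiff.1 hi
    exact lt_of_le_of_ne (hmin i (Finset.mem_symmDiff.2 (Or.inr ⟨hi1, hi2⟩)))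
      fun he => hi2 (he ▸ h1)
  · refine sum_ne_sum_of_halving hpos h hB hA (Finset.mem_sdiff.2 ⟨h1, h2⟩) (fun i hi => ?_)
      heq.symm
    obtain ⟨hi1, hi2⟩ := Finset.mem_sdiff.1 hi
    exact lt_of_le_of_ne (hmin i (Finset.mem_symmDiff.2 (Or.inl ⟨hi1, hi2⟩)))
      fun he => hi2 (he ▸ h1)

/-- A halving sequence of integer combinations of few reals with small coefficients is short,
since otherwise two of its subset sums coincide. -/
lemma two_pow_card_le_of_halving {ι : Type*} [Fintype ι] {m : ℕ} (hpos : ∀ j < m, 0 < y j)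
    (h : ∀ j, 2 * y (j + 1) ≤ y j) (x : ι → ℝ) (K : ℕ) {J : Finset ℕ} (hJ : J ⊆ Finset.range m)
    (hy : ∀ j ∈ J, ∃ a : ι → ℤ, (∀ i, |a i| ≤ K) ∧ y j = ∑ i, a i * x i) :
    2 ^ J.card ≤ (2 * J.card * K + 1) ^ Fintype.card ι := by
  classical
  choose! a ha hya using hy
  by_contra! hlt
  -- Coefficient vectors of subset sums lie in the box `[-|J| K, |J| K]` in each coordinate, which
  -- has fewer points than `J` has subsets.
  have hcard : (Fintype.piFinset fun _ : ι =>
      Finset.Icc (-(J.card * K : ℤ)) (J.card * K)).card < J.powerset.card := by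
    rw [Fintype.card_piFinset, Finset.card_powerset]
    simp only [Int.card_Icc, Finset.prod_const, Finset.card_univ]
    refine lt_of_eq_of_lt ?_ hlt
    congr 1
    have : ((J.card * K : ℤ) + 1 - -(J.card * K)) = ((2 * J.card * K + 1 : ℕ) : ℤ) := by
      push_cast; ring
    rw [this, Int.toNat_natCast]
  obtain ⟨A, hA, B, hB, hne, heq⟩ := Finset.exists_ne_map_eq_of_card_lt_of_maps_to hcard
    (f := fun A : Finset ℕ => fun i => ∑ j ∈ A, a j i) (by
      intro A hA
      have hA' := Finset.mem_powerset.1 hA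
      refine Fintype.mem_piFinset.2 fun i => ?_
      rw [Finset.mem_Icc, ← abs_le]
      calc |∑ j ∈ A, a j i| ≤ ∑ j ∈ A, |a j i| := Finset.abs_sum_le_sum_abs _ _
        _ ≤ ∑ j ∈ A, (K : ℤ) := Finset.sum_le_sum fun j hj => ha j (hA' hj) i
        _ = A.card * K := by simp
        _ ≤ J.card * K := by
          have := Finset.card_le_card hA'
          gcongr)
  rw [Finset.mem_powerset] at hA hB
  have hsum : ∀ D ⊆ J, ∑ j ∈ D, y j = ∑ i, ((∑ j ∈ D, a j i : ℤ) : ℝ) * x i := by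
    intro D hD
    rw [Finset.sum_congr rfl fun j hj => hya j (hD hj), Finset.sum_comm]
    simp only [Int.cast_sum, Finset.sum_mul]
  refine hne (eq_of_sum_eq_of_halving hpos h (hA.trans hJ) (hB.trans hJ) ?_)
  rw [hsum A hA, hsum B hB]
  refine Finset.sum_congr rfl fun i _ => ?_
  rw [congrFun heq i]

/-- Contradicts `two_pow_card_le_of_halving` for `K = n + 1` and `(n + 1) ^ 2` reals. With `k =
Nat.clog 2 n` the base is below `2 ^ (4 * k + 9)`, which the factor 16 absorbs. -/
lemma pow_lt_two_pow_clog {n : ℕ} (hn : 2 ≤ n) :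
    (2 * (16 * (n + 1) ^ 2 * Nat.clog 2 n) * (n + 1) + 1) ^ ((n + 1) ^ 2) <
      2 ^ (16 * (n + 1) ^ 2 * Nat.clog 2 n) := by
  set k := Nat.clog 2 n with hk
  have hk1 : 1 ≤ k := Nat.clog_pos (by norm_num) hn
  have hnk : n ≤ 2 ^ k := Nat.le_pow_clog (by norm_num) n
  have hn1 : n + 1 ≤ 2 ^ (k + 1) := by rw [pow_succ]; lia
  have hkk : k ≤ 2 ^ k := Nat.lt_two_pow_self.le
  rw [show 16 * (n + 1) ^ 2 * k = (16 * k) * (n + 1) ^ 2 by ring, pow_mul]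
  refine Nat.pow_lt_pow_left ?_ (by positivity)
  calc 2 * (16 * k * (n + 1) ^ 2) * (n + 1) + 1
      ≤ 2 * (16 * 2 ^ k * (2 ^ (k + 1)) ^ 2) * 2 ^ (k + 1) + 1 := by gcongr
    _ = 2 ^ (4 * k + 8) + 1 := by ring
    _ < 2 ^ (4 * k + 8) + 2 ^ (4 * k + 8) := by
      have := Nat.one_lt_two_pow (n := 4 * k + 8) (by lia)
      lia
    _ = 2 ^ (4 * k + 9) := by ring
    _ ≤ 2 ^ (16 * k) := Nat.pow_le_pow_right (by norm_num) (by lia)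

end Halving

/-! ### Vertices of L1 and L∞ balls in the simplex -/

section ExtremePoints

variable {S : Type*} [Fintype S]

/-- `q` is not the midpoint of two other points of `U`. -/
def IsVertexOf (U : Set (stdSimplex ℝ S)) (q : stdSimplex ℝ S) : Prop :=
  q ∈ U ∧ ∀ r ∈ U, ∀ r' ∈ U, (∀ s, r s + r' s = 2 * q s) → r = q

/-- Among the maximizers of a linear form there is a vertex at which a second linear form is as
small as at a given maximizer. -/
lemma exists_isVertexOf_of_isMaxOn {U : Set (stdSimplex ℝ S)} (hU : IsCompact U) (v w : S → ℝ)
    {p : stdSimplex ℝ S} (hp : p ∈ U) (hmax : ∀ r ∈ U, ∑ s, r s * v s ≤ ∑ s, p s * v s) :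
    ∃ q, IsVertexOf U q ∧ ∑ s, p s * v s ≤ ∑ s, q s * v s ∧
      ∑ s, q s * w s ≤ ∑ s, p s * w s := by
  have hF : IsCompact (U ∩ {q | ∑ s, p s * v s ≤ ∑ s, q s * v s}) :=
    hU.inter_right (isClosed_le continuous_const (RMC.continuous_sum_mul v))
  obtain ⟨f, ⟨hfU, hfv⟩, hfmin⟩ := hF.exists_isMinOn ⟨p, hp, hmax p hp⟩
    (RMC.continuous_sum_mul w).continuousOn
  -- On this face of a face, a point of greatest Euclidean norm is taken. If it is a midpoint in
  -- `U`, both linear forms force the endpoints into the face, and the parallelogram identity makes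
  -- them coincide.
  have hG : IsCompact (U ∩ {q | ∑ s, p s * v s ≤ ∑ s, q s * v s} ∩
      {q | ∑ s, q s * w s ≤ ∑ s, f s * w s}) :=
    hF.inter_right (isClosed_le (RMC.continuous_sum_mul w) continuous_const)
  have hsq : Continuous fun q : stdSimplex ℝ S => ∑ s, q s * q s :=
    continuous_finsetSum _ fun s _ => ((continuous_apply s).comp continuous_subtype_val).mul
      ((continuous_apply s).comp continuous_subtype_val)
  obtain ⟨q, ⟨⟨hqU, hqv⟩, hqw⟩, hqmax⟩ := hG.exists_isMaxOn ⟨f, ⟨hfU, hfv⟩, le_refl (∑ s, f s * w s)⟩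
    hsq.continuousOn
  have hfp : ∑ s, f s * w s ≤ ∑ s, p s * w s := hfmin ⟨hp, hmax p hp⟩
  simp only [Set.mem_ofPred_eq] at hqv hqw
  refine ⟨q, ⟨hqU, fun r hr r' hr' hrr => ?_⟩, hqv, hqw.trans hfp⟩
  have hlin : ∀ u : S → ℝ, ∑ s, r s * u s + ∑ s, r' s * u s = 2 * ∑ s, q s * u s := by
    intro u
    rw [← Finset.sum_add_distrib, Finset.mul_sum]
    refine Finset.sum_congr rfl fun s _ => ?_
    rw [← add_mul, hrr s]
    ring
  have hrF : ∑ s, p s * v s ≤ ∑ s, r s * v s := by linarith [hlin v, hmax r' hr']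
  have hrF' : ∑ s, p s * v s ≤ ∑ s, r' s * v s := by linarith [hlin v, hmax r hr]
  have h1 : ∑ s, f s * w s ≤ ∑ s, r s * w s := hfmin ⟨hr, hrF⟩
  have h2 : ∑ s, f s * w s ≤ ∑ s, r' s * w s := hfmin ⟨hr', hrF'⟩
  have hrG : ∑ s, r s * w s ≤ ∑ s, f s * w s := by linarith [hlin w]
  have hrG' : ∑ s, r' s * w s ≤ ∑ s, f s * w s := by linarith [hlin w]
  have h3 : ∑ s, r s * r s ≤ ∑ s, q s * q s := hqmax ⟨⟨hr, hrF⟩, hrG⟩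
  have h4 : ∑ s, r' s * r' s ≤ ∑ s, q s * q s := hqmax ⟨⟨hr', hrF'⟩, hrG'⟩
  have h5 : ∑ s, (r s - q s) ^ 2 ≤ 0 := by
    have : ∑ s, r s * r s + ∑ s, r' s * r' s =
        2 * ∑ s, q s * q s + 2 * ∑ s, (r s - q s) ^ 2 := by
      rw [← Finset.sum_add_distrib, Finset.mul_sum, Finset.mul_sum, ← Finset.sum_add_distrib]
      refine Finset.sum_congr rfl fun s _ => ?_
      rw [show r' s = 2 * q s - r s by linarith [hrr s]]
      ring
    linarith
  have h6 := (Finset.sum_eq_zero_iff_of_nonneg fun s _ => sq_nonneg (r s - q s)).1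
    (le_antisymm h5 (Finset.sum_nonneg fun s _ => sq_nonneg _))
  refine stdSimplex.ext (funext fun s => ?_)
  exact sub_eq_zero.1 ((pow_eq_zero_iff two_ne_zero).1 (h6 s (Finset.mem_univ s)))

lemma exists_transfer (q : stdSimplex ℝ S) {i j : S} (hij : i ≠ j) {ε : ℝ} (h0 : 0 ≤ ε)
    (hj : ε ≤ q j) :
    ∃ r : stdSimplex ℝ S, r i = q i + ε ∧ r j = q j - ε ∧ ∀ k, k ≠ i → k ≠ j → r k = q k := by
  classical
  refine ⟨⟨fun k => q k + ((if k = i then ε else 0) - if k = j then ε else 0), fun k => ?_, ?_⟩,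
    ?_, ?_, ?_⟩
  · have := stdSimplex.zero_le q k
    by_cases hk : k = j
    · subst hk; simp [hij.symm, hj]
    · simp only [hk, if_false]; split_ifs <;> linarith
  · rw [Finset.sum_add_distrib, stdSimplex.sum_eq_one, Finset.sum_sub_distrib]
    simp
  · change q i + _ = _; simp [hij]
  · change q j + _ = _; simp [hij.symm]; ring
  · intro k hi hj
    change q k + _ = _; simp [hi, hj]

/-- Mass cannot be transferred in both directions between two coordinates of a vertex. -/
lemma IsVertexOf.false_of_transfer {U : Set (stdSimplex ℝ S)} {q : stdSimplex ℝ S}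
    (hq : IsVertexOf U q) {i j : S} (hij : i ≠ j) {ε : ℝ} (hε : 0 < ε) (hi : ε ≤ q i)
    (hj : ε ≤ q j)
    (h : ∀ (r : stdSimplex ℝ S) (e : ℝ), |e| = ε → r i = q i + e → r j = q j - e →
      (∀ k, k ≠ i → k ≠ j → r k = q k) → r ∈ U) : False := by
  obtain ⟨r, r1, r2, r3⟩ := exists_transfer q hij hε.le hj
  obtain ⟨r', r1', r2', r3'⟩ := exists_transfer q hij.symm hε.le hi
  have hr := h r ε (abs_of_pos hε) r1 r2 r3
  have hr' := h r' (-ε) (by rw [abs_neg, abs_of_pos hε]) (by linarith) (by linarith)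
    fun k hk hk' => r3' k hk' hk
  have := hq.2 r hr r' hr' fun s => by
    by_cases hsi : s = i
    · subst hsi; linarith
    by_cases hsj : s = j
    · subst hsj; linarith
    rw [r3 s hsi hsj, r3' s hsj hsi]; ring
  rw [this] at r1
  linarith

/-- All coordinates of `q` but one are small integer combinations of the coordinate of `p` and
of `d`. -/
def IsBasicPoint (p : S → ℝ) (d : ℝ) (q : stdSimplex ℝ S) : Prop :=
  ∃ k, ∀ i, i ≠ k → ∃ a b : ℤ, |a| ≤ 1 ∧ |b| ≤ 1 ∧ q i = a * p i + b * d

/-- Two positive coordinates with slack could exchange a little mass both ways. So all but at most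
one coordinate are 0 or `p i ± δ`. -/
lemma IsVertexOf.isBasicPoint_linfty {A : Set S} {p : stdSimplex ℝ S} {δ : ℝ}
    {q : stdSimplex ℝ S}
    (hq : IsVertexOf {q | (∀ s ∉ A, q s = 0) ∧ ∀ s, |q s - p s| ≤ δ} q) :
    IsBasicPoint p δ q := by
  obtain ⟨hA, hδ⟩ := hq.1
  have key : ∀ i j, i ≠ j → 0 < q i → |q i - p i| < δ → 0 < q j → |q j - p j| < δ → False := by
    intro i j hij hi hi' hj hj'
    obtain ⟨ε, hε, h1, h2, h3, h4⟩ : ∃ ε, 0 < ε ∧ ε ≤ q i ∧ ε ≤ q j ∧ ε ≤ δ - |q i - p i| ∧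
        ε ≤ δ - |q j - p j| := by
      refine ⟨min (min (q i) (q j)) (min (δ - |q i - p i|) (δ - |q j - p j|)), ?_, ?_, ?_, ?_, ?_⟩
      · refine lt_min (lt_min hi hj) (lt_min ?_ ?_) <;> linarith
      all_goals simp
    refine hq.false_of_transfer hij hε h1 h2 fun r e he ri rj rk => ⟨fun s hs => ?_, fun s => ?_⟩
    · have hqs := hA s hs
      rw [rk s (by rintro rfl; linarith) (by rintro rfl; linarith), hqs]
    · by_cases hsi : s = i
      · subst hsi
        have := abs_add_le (q s - p s) e
        rw [ri, show q s + e - p s = (q s - p s) + e by ring]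
        linarith
      by_cases hsj : s = j
      · subst hsj
        have := abs_sub (q s - p s) e
        rw [rj, show q s - e - p s = (q s - p s) - e by ring]
        linarith
      rw [rk s hsi hsj]; exact hδ s
  have bound : ∀ i, ¬ (0 < q i ∧ |q i - p i| < δ) →
      ∃ a b : ℤ, |a| ≤ 1 ∧ |b| ≤ 1 ∧ q i = a * p i + b * δ := by
    intro i hi
    rcases (stdSimplex.zero_le q i).eq_or_lt with h | h
    · exact ⟨0, 0, by simp, by simp, by simp [← h]⟩
    have h2 : |q i - p i| = δ := le_antisymm (hδ i) (not_lt.1 fun h' => hi ⟨h, h'⟩)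
    rcases abs_choice (q i - p i) with h3 | h3
    · exact ⟨1, 1, by simp, by simp, by push_cast; linarith⟩
    · exact ⟨1, -1, by simp, by simp, by push_cast; linarith⟩
  by_cases hex : ∃ k, 0 < q k ∧ |q k - p k| < δ
  · obtain ⟨k, hk, hk'⟩ := hex
    exact ⟨k, fun i hik => bound i fun h => key i k hik h.1 h.2 hk hk'⟩
  · have hne : Nonempty S := by
      by_contra hne
      rw [not_nonempty_iff] at hne
      simpa using stdSimplex.sum_eq_one q
    exact ⟨hne.some, fun i _ => bound i fun h => hex ⟨i, h⟩⟩

/-- Exchanging mass between two raised, or two lowered but positive, coordinates keeps the L1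
distance, so there is at most one of each kind. If both kinds occur, the distance is exactly `δ` and
the raised coordinate is `p i + δ / 2`; the lowered one serves as the exception. -/
lemma IsVertexOf.isBasicPoint_l1 {A : Set S} {p : stdSimplex ℝ S} {δ : ℝ} {q : stdSimplex ℝ S}
    (hq : IsVertexOf {q | (∀ s ∉ A, q s = 0) ∧ ∑ s, |q s - p s| ≤ δ} q) :
    IsBasicPoint p (δ / 2) q := by
  obtain ⟨hA, hδ⟩ := hq.1
  have hp0 : ∀ i, 0 ≤ p i := stdSimplex.zero_le p
  have hq0 : ∀ i, 0 ≤ q i := stdSimplex.zero_le q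
  have key : ∀ i j, i ≠ j → ∀ ε, 0 < ε → ε ≤ q i → ε ≤ q j →
      (∀ e, |e| = ε → ∑ s, |q s - p s| + (|q i + e - p i| - |q i - p i|) +
        (|q j - e - p j| - |q j - p j|) ≤ δ) → False := by
    intro i j hij ε hε h1 h2 h3
    refine hq.false_of_transfer hij hε h1 h2 fun r e he ri rj rk => ⟨fun s hs => ?_, ?_⟩
    · have hqs := hA s hs
      rw [rk s (by rintro rfl; linarith) (by rintro rfl; linarith), hqs]
    · have := Fintype.sum_eq_add (f := fun s => |r s - p s| - |q s - p s|) i j hij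
        fun s hs => by rw [rk s hs.1 hs.2, sub_self]
      rw [Finset.sum_sub_distrib, ri, rj] at this
      linarith [h3 e he]
  have up_up : ∀ i j, i ≠ j → p i < q i → p j < q j → False := by
    intro i j hij hi hj
    have m1 := min_le_left (q i - p i) (q j - p j)
    have m2 := min_le_right (q i - p i) (q j - p j)
    refine key i j hij (min (q i - p i) (q j - p j)) (lt_min (by linarith) (by linarith))
      (by linarith [hp0 i]) (by linarith [hp0 j]) fun e he => ?_
    have e1 := le_abs_self e
    have e2 := neg_abs_le e
    rw [abs_of_nonneg (by linarith : 0 ≤ q i + e - p i), abs_of_pos (by linarith : 0 < q i - p i),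
      abs_of_nonneg (by linarith : 0 ≤ q j - e - p j), abs_of_pos (by linarith : 0 < q j - p j)]
    linarith
  have down_down : ∀ i j, i ≠ j → 0 < q i → q i < p i → 0 < q j → q j < p j → False := by
    intro i j hij hi hi' hj hj'
    obtain ⟨ε, hε, h1, h2, h3, h4⟩ : ∃ ε, 0 < ε ∧ ε ≤ q i ∧ ε ≤ q j ∧ ε ≤ p i - q i ∧
        ε ≤ p j - q j := by
      refine ⟨min (min (q i) (q j)) (min (p i - q i) (p j - q j)), ?_, ?_, ?_, ?_, ?_⟩
      · refine lt_min (lt_min hi hj) (lt_min ?_ ?_) <;> linarith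
      all_goals simp
    refine key i j hij ε hε h1 h2 fun e he => ?_
    have e1 := le_abs_self e
    have e2 := neg_abs_le e
    rw [abs_of_nonpos (by linarith : q i + e - p i ≤ 0), abs_of_neg (by linarith : q i - p i < 0),
      abs_of_nonpos (by linarith : q j - e - p j ≤ 0), abs_of_neg (by linarith : q j - p j < 0)]
    linarith
  have up_down : ∀ i j, p i < q i → 0 < q j → q j < p j → ∑ s, |q s - p s| = δ := by
    intro i j hi hj hj'
    by_contra hne
    have hlt := lt_of_le_of_ne hδ hne
    have hij : i ≠ j := by rintro rfl; linarith
    -- Here an exchange of `ε` changes the distance by up to `2 * ε`, hence half the slack.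
    obtain ⟨ε, hε, h1, h2, h3, h4⟩ : ∃ ε, 0 < ε ∧ ε ≤ q i - p i ∧ ε ≤ q j ∧ ε ≤ p j - q j ∧
        ε ≤ (δ - ∑ s, |q s - p s|) / 2 := by
      refine ⟨min (min (q i - p i) (q j)) (min (p j - q j) ((δ - ∑ s, |q s - p s|) / 2)),
        ?_, ?_, ?_, ?_, ?_⟩
      · refine lt_min (lt_min ?_ hj) (lt_min ?_ ?_) <;> linarith
      all_goals simp
    refine key i j hij ε hε (by linarith [hp0 i]) h2 fun e he => ?_
    have e1 := le_abs_self e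
    have e2 := neg_abs_le e
    rw [abs_of_nonneg (by linarith : 0 ≤ q i + e - p i), abs_of_pos (by linarith : 0 < q i - p i),
      abs_of_nonpos (by linarith : q j - e - p j ≤ 0), abs_of_neg (by linarith : q j - p j < 0)]
    linarith
  have bound : ∀ i, ¬ p i < q i → ¬ (0 < q i ∧ q i < p i) →
      ∃ a b : ℤ, |a| ≤ 1 ∧ |b| ≤ 1 ∧ q i = a * p i + b * (δ / 2) := by
    intro i hi hi'
    rcases (hq0 i).eq_or_lt with h | h
    · exact ⟨0, 0, by simp, by simp, by simp [← h]⟩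
    · have : q i = p i := le_antisymm (not_lt.1 hi) (not_lt.1 fun h' => hi' ⟨h, h'⟩)
      exact ⟨1, 0, by simp, by simp, by simp [this]⟩
  by_cases hdown : ∃ k, 0 < q k ∧ q k < p k
  · obtain ⟨k, hk, hk'⟩ := hdown
    refine ⟨k, fun i hik => ?_⟩
    by_cases hi : p i < q i
    · have h1 := up_down i k hi hk hk'
      -- Each summand is twice a positive part, nonzero only at `i`; the signed differences sum to
      -- 0.
      have h2 : ∑ s, (|q s - p s| + (q s - p s)) = 2 * (q i - p i) := by
        rw [Fintype.sum_eq_single i, abs_of_pos (by linarith)]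
        · ring
        · intro s hs
          have : q s ≤ p s := not_lt.1 fun h => up_up s i hs h hi
          rw [abs_of_nonpos (by linarith)]
          ring
      rw [Finset.sum_add_distrib, Finset.sum_sub_distrib, stdSimplex.sum_eq_one,
        stdSimplex.sum_eq_one, h1] at h2
      exact ⟨1, 1, by simp, by simp, by push_cast; linarith⟩
    · exact bound i hi fun h => down_down i k hik h.1 h.2 hk hk'
  · by_cases hup : ∃ k, p k < q k
    · obtain ⟨k, hk⟩ := hup
      exact ⟨k, fun i hik => bound i (fun h => up_up i k hik h hk) fun h => hdown ⟨i, h⟩⟩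
    · have hne : Nonempty S := by
        by_contra hne
        rw [not_nonempty_iff] at hne
        simpa using stdSimplex.sum_eq_one q
      exact ⟨hne.some, fun i _ => bound i (fun h => hup ⟨i, h⟩) fun h => hdown ⟨i, h⟩⟩

/-- The reals whose integer combinations express `X - ∑ i, q i * v i` for basic points `q`. -/
noncomputable def basicTerms (p : S → ℝ) (d X : ℝ) (v : S → ℝ) : Option S × Option S → ℝ
  | (some j, some i) => v j * p i
  | (some j, none) => v j * d
  | (none, some j) => v j
  | (none, none) => X

/-- Total mass 1 eliminates the exceptional coordinate `k`: `q · v = v k + ∑ s, (a s * p s + b s *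
d) * (v s - v k)`. The largest coefficient bound, `n + 1`, comes from `∑ i, b i - b k` at `v k * d`.
-/
lemma IsBasicPoint.exists_coeff {p : S → ℝ} {d : ℝ} {q : stdSimplex ℝ S}
    (h : IsBasicPoint p d q) (X : ℝ) (v : S → ℝ) :
    ∃ c : Option S × Option S → ℤ, (∀ i, |c i| ≤ (Fintype.card S + 1 : ℕ)) ∧
      X - ∑ s, q s * v s = ∑ i, c i * basicTerms p d X v i := by
  classical
  obtain ⟨k, hk⟩ := h
  have hk' : ∀ i, ∃ a b : ℤ, |a| ≤ 1 ∧ |b| ≤ 1 ∧ (i ≠ k → q i = a * p i + b * d) := by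
    intro i
    by_cases hi : i = k
    · exact ⟨0, 0, by simp, by simp, fun h => absurd hi h⟩
    · obtain ⟨a, b, ha, hb, he⟩ := hk i hi
      exact ⟨a, b, ha, hb, fun _ => he⟩
  choose a b ha hb he using hk'
  have hcard : 1 ≤ Fintype.card S := Fintype.card_pos_iff.2 ⟨k⟩
  have hB : |∑ i, b i| ≤ Fintype.card S :=
    calc |∑ i, b i| ≤ ∑ i, |b i| := Finset.abs_sum_le_sum_abs _ _
      _ ≤ ∑ i : S, (1 : ℤ) := Finset.sum_le_sum fun i _ => hb i
      _ = Fintype.card S := by simp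
  let c : Option S × Option S → ℤ := fun x => match x with
    | (some j, some i) => (if j = k then a i else 0) - if j = i then a i else 0
    | (some j, none) => (if j = k then ∑ i, b i else 0) - b j
    | (none, some j) => if j = k then -1 else 0
    | (none, none) => 1
  refine ⟨c, ?_, ?_⟩
  · rintro ⟨_ | j, _ | i⟩
    · simp [c]
    · simp only [c]
      split_ifs
      · simp
      · simp only [abs_zero]; positivity
    · have := hb j
      simp only [c]
      push_cast
      split_ifs
      · exact (abs_sub _ _).trans (by linarith)
      · rw [zero_sub, abs_neg]; lia
    · have := ha i
      simp only [c]
      push_cast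
      split_ifs <;> simp <;> lia
  · have hval : ∑ s, q s * v s = v k + ∑ s, (a s * p s + b s * d) * (v s - v k) := by
      have : ∀ s, (a s * p s + b s * d) * (v s - v k) = q s * v s - q s * v k := by
        intro s
        by_cases hs : s = k
        · subst hs; ring
        · rw [← he s hs]; ring
      rw [Finset.sum_congr rfl fun s _ => this s, Finset.sum_sub_distrib, ← Finset.sum_mul,
        stdSimplex.sum_eq_one]
      ring
    rw [hval]
    simp only [Fintype.sum_prod_type, Fintype.sum_option, c, basicTerms]
    push_cast
    simp only [sub_mul, Finset.sum_sub_distrib, Finset.sum_add_distrib, ite_mul, zero_mul,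
      mul_sub, add_mul, Finset.sum_ite_eq', Finset.sum_ite_eq, Finset.mem_univ, if_true]
    have e1 : ∑ j, ∑ i, (if j = k then (a i : ℝ) * (v j * p i) else 0) =
        ∑ i, (a i : ℝ) * p i * v k := by
      rw [Finset.sum_comm]
      refine Finset.sum_congr rfl fun i _ => ?_
      simp; ring
    have e2 : ∀ x y z : ℝ, x * (y * z) = x * z * y := fun x y z => by ring
    rw [e1]
    simp only [Finset.sum_mul, e2]
    ring

end ExtremePoints

/-! ### Policy improvement as a batch chain with the same kind of uncertainty -/

section LpNorm

variable {S : Type*} [Fintype S]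

lemma norm_toLp_one (f : S → ℝ) :
    ‖(WithLp.toLp 1 f : PiLp 1 fun _ : S => ℝ)‖ = ∑ s, |f s| := by
  simp [PiLp.norm_eq_of_L1]

lemma norm_toLp_top_le_iff [Nonempty S] (f : S → ℝ) (δ : ℝ) :
    ‖(WithLp.toLp ⊤ f : PiLp ⊤ fun _ : S => ℝ)‖ ≤ δ ↔ ∀ s, |f s| ≤ δ := by
  rw [PiLp.norm_eq_ciSup, ciSup_le_iff (Set.finite_range _).bddAbove]
  rfl

/-- Makes singleton uncertainty sets balls of radius 0. -/
lemma norm_toLp_nonpos_iff {p : ℝ≥0∞} (hp : p = 1 ∨ p = ⊤) (f : S → ℝ) :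
    ‖(WithLp.toLp p f : PiLp p fun _ : S => ℝ)‖ ≤ 0 ↔ ∀ s, f s = 0 := by
  have : Fact (1 ≤ p) := ⟨by rcases hp with rfl | rfl <;> simp⟩
  rw [norm_le_zero_iff, WithLp.toLp_eq_zero, funext_iff]
  rfl

lemma norm_toLp_sumElim_zero_le_iff [Nonempty S] {p : ℝ≥0∞} (hp : p = 1 ∨ p = ⊤) (f : S → ℝ)
    (δ : ℝ) :
    ‖(WithLp.toLp p (Sum.elim (fun _ : S => 0) f) : PiLp p fun _ : S ⊕ S => ℝ)‖ ≤ δ ↔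
      ‖(WithLp.toLp p f : PiLp p fun _ : S => ℝ)‖ ≤ δ := by
  rcases hp with rfl | rfl
  · rw [norm_toLp_one, norm_toLp_one, Fintype.sum_sum_type]
    simp
  · rw [norm_toLp_top_le_iff, norm_toLp_top_le_iff, Sum.forall]
    simp only [Sum.elim_inl, Sum.elim_inr, abs_zero, and_iff_right_iff_imp]
    exact fun h _ => (abs_nonneg _).trans (h (Classical.arbitrary S))

end LpNorm

section MapInr

variable {S : Type*} [Fintype S]

lemma stdSimplex.map_inr_inl (q : stdSimplex ℝ S) (s : S) :
    stdSimplex.map (Sum.inr : S → S ⊕ S) q (Sum.inl s) = 0 := by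
  classical
  rw [stdSimplex.map_coe, FunOnFinite.linearMap_apply_apply]
  simp

lemma stdSimplex.map_inr_inr (q : stdSimplex ℝ S) (s : S) :
    stdSimplex.map (Sum.inr : S → S ⊕ S) q (Sum.inr s) = q s := by
  classical
  rw [stdSimplex.map_coe, FunOnFinite.linearMap_apply_apply]
  simp only [Sum.inr.injEq]
  exact Finset.sum_eq_single_of_mem s (by simp) (by simp +contextual)

lemma stdSimplex.map_inr_injective :
    Function.Injective (stdSimplex.map (Sum.inr : S → S ⊕ S) : stdSimplex ℝ S → _) := by
  intro q r h
  refine stdSimplex.ext (funext fun s => ?_)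
  rw [← stdSimplex.map_inr_inr q s, h, stdSimplex.map_inr_inr]

lemma stdSimplex.exists_map_inr_eq {q : stdSimplex ℝ (S ⊕ S)} (h : ∀ s, q (Sum.inl s) = 0) :
    ∃ r : stdSimplex ℝ S, stdSimplex.map Sum.inr r = q := by
  refine ⟨⟨fun s => q (Sum.inr s), fun s => stdSimplex.zero_le q _, ?_⟩, ?_⟩
  · have := stdSimplex.sum_eq_one q
    rw [Fintype.sum_sum_type] at this
    simpa [h] using this
  · refine stdSimplex.ext (funext fun x => ?_)
    rcases x with s | s
    · rw [stdSimplex.map_inr_inl, h]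
    · rw [stdSimplex.map_inr_inr]; rfl

lemma stdSimplex.sum_map_inr_mul (q : stdSimplex ℝ S) (x : S ⊕ S → ℝ) :
    ∑ i, stdSimplex.map (Sum.inr : S → S ⊕ S) q i * x i = ∑ s, q s * x (Sum.inr s) := by
  simp only [Fintype.sum_sum_type, stdSimplex.map_inr_inl, stdSimplex.map_inr_inr, zero_mul,
    Finset.sum_const_zero, zero_add]

lemma stdSimplex.sum_vertex_mul [DecidableEq S] (s : S) (x : S → ℝ) :
    ∑ i, (stdSimplex.vertex s : stdSimplex ℝ S) i * x i = x s := by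
  simp [Pi.single_apply]

end MapInr

namespace RMC

variable {S : Type*} [Fintype S]

lemma ofChain_hasLpUncertainty (c : S → ℝ) (P : S → stdSimplex ℝ S) {p : ℝ≥0∞}
    (hp : p = 1 ∨ p = ⊤) : (ofChain c P).HasLpUncertainty p := by
  refine ⟨P, fun _ => 0, fun s s' h => by simpa [ofChain] using h, fun s => ?_⟩
  ext q
  simp only [Set.mem_ofPred_eq, norm_toLp_nonpos_iff hp, sub_eq_zero]
  constructor
  · intro hq
    have : q = P s := hq
    exact ⟨(ofChain c P).supported s q hq, fun s' => by rw [this]⟩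
  · rintro ⟨-, h⟩
    exact stdSimplex.ext (funext h)

variable [DecidableEq S] (M : RMC S) {γ : ℝ} (v : S → ℝ)

lemma value_ofChain (h0 : 0 ≤ γ) (h1 : γ < 1) (τ : S → stdSimplex ℝ S) :
    (ofChain M.cost τ).value γ = M.policyEval γ τ := by
  refine IsBellmanSolution.eq_value h0 h1 (τ := τ)
    ⟨M.policyEval_apply h0 h1 τ, fun s => ⟨rfl, fun q hq => ?_⟩⟩
  rw [show q = τ s from hq]

lemma batch_hasLpUncertainty {p : ℝ≥0∞} (hp : p = 1 ∨ p = ⊤) (h : M.HasLpUncertainty p) :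
    (M.batch γ v).HasLpUncertainty p := by
  obtain ⟨nom, δ, hsupp, hU⟩ := h
  have hdiff : ∀ r s, (fun x => stdSimplex.map (Sum.inr : S → S ⊕ S) r x -
      stdSimplex.map Sum.inr (nom s) x) = Sum.elim (fun _ => 0) fun s' => r s' - nom s s' := by
    intro r s
    funext x
    rcases x with x | x <;> simp [stdSimplex.map_inr_inl, stdSimplex.map_inr_inr]
  refine ⟨Sum.elim (fun s => stdSimplex.map Sum.inr (nom s))
    fun s => stdSimplex.vertex (Sum.inr s), Sum.elim δ fun _ => 0, ?_, ?_⟩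
  · rintro (s | s) (x | x) hx
    · exact stdSimplex.map_inr_inl _ _
    · refine (stdSimplex.map_inr_inr _ _).trans (hsupp s x fun hxs => hx ⟨x, hxs, rfl⟩)
    · exact (M.batch γ v).supported (Sum.inr s) _ rfl _ hx
    · exact (M.batch γ v).supported (Sum.inr s) _ rfl _ hx
  · rintro (s | s)
    · have : Nonempty S := ⟨s⟩
      ext q
      constructor
      · intro hq
        refine ⟨(M.batch γ v).supported (Sum.inl s) q hq, ?_⟩
        obtain ⟨r, hr, rfl⟩ := hq
        rw [hU s] at hr
        simp only [Sum.elim_inl]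
        rw [hdiff, norm_toLp_sumElim_zero_le_iff hp]
        exact hr.2
      · rintro ⟨h1, h2⟩
        have h1' : ∀ x, x ∉ (Sum.inr '' M.succ s : Set (S ⊕ S)) → q x = 0 := h1
        -- The support condition excludes mass on the transient copies, so the larger simplex adds
        -- no points to the ball.
        obtain ⟨r, rfl⟩ := stdSimplex.exists_map_inr_eq fun x => h1' (Sum.inl x) (by simp)
        refine ⟨r, ?_, rfl⟩
        rw [hU s]
        simp only [Sum.elim_inl] at h2
        rw [hdiff, norm_toLp_sumElim_zero_le_iff hp] at h2
        refine ⟨fun x hx => ?_, h2⟩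
        rw [← stdSimplex.map_inr_inr r x]
        exact h1' _ (by simpa using hx)
    · ext q
      simp only [Sum.elim_inr, Set.mem_ofPred_eq, norm_toLp_nonpos_iff hp, sub_eq_zero]
      constructor
      · intro hq
        refine ⟨(M.batch γ v).supported (Sum.inr s) q hq, fun x => ?_⟩
        rw [show q = stdSimplex.vertex (Sum.inr s) from hq]
      · rintro ⟨-, h⟩
        exact stdSimplex.ext (funext h)

/-- Paying `(1 - γ) * v s` forever is worth `v s`. -/
lemma batch_policyEval_inr (h0 : 0 ≤ γ) (h1 : γ < 1) {σ : S ⊕ S → stdSimplex ℝ (S ⊕ S)}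
    (hσ : (M.batch γ v).IsPolicy σ) (s : S) :
    (M.batch γ v).policyEval γ σ (Sum.inr s) = v s := by
  have h := (M.batch γ v).policyEval_apply h0 h1 σ (Sum.inr s)
  rw [show σ (Sum.inr s) = stdSimplex.vertex (Sum.inr s) from hσ (Sum.inr s),
    stdSimplex.sum_vertex_mul, show (M.batch γ v).cost (Sum.inr s) = (1 - γ) * v s from rfl] at h
  have : (1 - γ) * ((M.batch γ v).policyEval γ σ (Sum.inr s) - v s) = 0 := by linarith
  rcases mul_eq_zero.1 this with h | h <;> linarith

lemma batch_policyEval_inl (h0 : 0 ≤ γ) (h1 : γ < 1) {σ : S ⊕ S → stdSimplex ℝ (S ⊕ S)}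
    (hσ : (M.batch γ v).IsPolicy σ) {s : S} {q : stdSimplex ℝ S}
    (hq : σ (Sum.inl s) = stdSimplex.map Sum.inr q) :
    (M.batch γ v).policyEval γ σ (Sum.inl s) = M.cost s + γ * ∑ s', q s' * v s' := by
  rw [(M.batch γ v).policyEval_apply h0 h1 σ (Sum.inl s), hq, stdSimplex.sum_map_inr_mul]
  simp only [M.batch_policyEval_inr v h0 h1 hσ]
  rfl

/-- Policy improvement is the solution of the batch robust Markov chain. -/
lemma isImprovement_iff_batch (h0 : 0 ≤ γ) (h1 : γ < 1) (τ' : S → stdSimplex ℝ S) :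
    M.IsImprovement γ v τ' ↔ ∃ σ, (M.batch γ v).IsOptimal γ σ ∧
      ∀ s, σ (Sum.inl s) = stdSimplex.map Sum.inr (τ' s) := by
  constructor
  · intro h
    let σ : S ⊕ S → stdSimplex ℝ (S ⊕ S) :=
      Sum.elim (fun s => stdSimplex.map Sum.inr (τ' s)) fun s => stdSimplex.vertex (Sum.inr s)
    have hσ : (M.batch γ v).IsPolicy σ := by
      rintro (s | s)
      · exact ⟨τ' s, (h s).1, rfl⟩
      · rfl
    refine ⟨σ, ((M.batch γ v).isOptimal_iff_policyEval_eq h0 h1).2 ⟨hσ, ?_⟩, fun s => rfl⟩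
    refine (M.batch γ v).policyEval_eq_value_of_isImprovement h0 h1 fun x => ⟨hσ x, ?_⟩
    rcases x with s | s
    · rintro _ ⟨r, hr, rfl⟩
      rw [show σ (Sum.inl s) = stdSimplex.map Sum.inr (τ' s) from rfl,
        stdSimplex.sum_map_inr_mul, stdSimplex.sum_map_inr_mul]
      simp only [M.batch_policyEval_inr v h0 h1 hσ]
      exact (h s).2 r hr
    · intro q hq
      rw [show q = σ (Sum.inr s) from hq]
  · rintro ⟨σ, hopt, hσ⟩ s
    obtain ⟨hpol, hval⟩ := ((M.batch γ v).isOptimal_iff_policyEval_eq h0 h1).1 hopt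
    obtain ⟨r, hr, hrs⟩ := hpol (Sum.inl s)
    have hr' : r = τ' s := stdSimplex.map_inr_injective (hrs.trans (hσ s))
    refine ⟨hr' ▸ hr, fun q hq => ?_⟩
    -- Deviating to `q` at one transient state cannot beat the optimal value, which is the required
    -- inequality.
    have hpol' : (M.batch γ v).IsPolicy
        (Function.update σ (Sum.inl s) (stdSimplex.map Sum.inr q)) := by
      intro x
      by_cases hx : x = Sum.inl s
      · subst hx
        rw [Function.update_self]
        exact ⟨q, hq, rfl⟩
      · rw [Function.update_of_ne hx]
        exact hpol x
    have hle := (M.batch γ v).policyEval_le_value h0 h1 hpol' (Sum.inl s)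
    rwa [← hval, M.batch_policyEval_inl v h0 h1 hpol (hσ s),
      M.batch_policyEval_inl v h0 h1 hpol' (Function.update_self _ _ _)] at hle

end RMC

/-! ### Convergence of policy iteration -/

/-- A halving sequence whose terms are, for each `j`, small integer combinations of one of the
families `x s` reaches a nonpositive value soon. -/
lemma exists_nonpos_of_halving {S : Type*} [Fintype S] (hn : 2 ≤ Fintype.card S) {z : ℕ → ℝ}
    (hz : ∀ j, 2 * z (j + 1) ≤ z j) (x : S → Option S × Option S → ℝ)
    (hx : ∀ j, ∃ s, ∃ a : Option S × Option S → ℤ, (∀ i, |a i| ≤ (Fintype.card S + 1 : ℕ)) ∧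
      z j = ∑ i, a i * x s i) :
    ∃ j < Fintype.card S * (16 * (Fintype.card S + 1) ^ 2 * Nat.clog 2 (Fintype.card S)),
      z j ≤ 0 := by
  classical
  set n := Fintype.card S with hncard
  set l := 16 * (n + 1) ^ 2 * Nat.clog 2 n with hl
  by_contra! hpos
  choose f hf using hx
  have hne : (Finset.univ : Finset S).Nonempty := by
    rw [← Finset.card_pos, Finset.card_univ]
    lia
  -- Pigeonhole: among `n * l` indices, some state accounts for at least `l`.
  obtain ⟨s, -, hs⟩ := Finset.exists_le_card_fiber_of_mul_le_card_of_maps_to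
    (s := Finset.range (n * l)) (t := Finset.univ) (f := f) (n := l)
    (fun _ _ => Finset.mem_univ _) hne (by simp [← hncard])
  obtain ⟨J, hJ, hJl⟩ := Finset.exists_subset_card_eq hs
  have h := two_pow_card_le_of_halving hpos hz (x s) (n + 1)
    (hJ.trans (Finset.filter_subset _ _)) fun j hj => by
      have := hf j
      rwa [(Finset.mem_filter.1 (hJ hj)).2] at this
  rw [hJl, Fintype.card_prod, Fintype.card_option, ← hncard, ← pow_two] at h
  exact absurd h (not_le.2 (pow_lt_two_pow_clog hn))

namespace RMC

variable {S : Type*} [Fintype S]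

lemma HasLpUncertainty.isBasicPoint {M : RMC S} {p : ℝ≥0∞} (hp : p = 1 ∨ p = ⊤)
    (h : M.HasLpUncertainty p) :
    ∃ (nominal : S → S → ℝ) (d : S → ℝ),
      ∀ s q, IsVertexOf (M.uncertainty s) q → IsBasicPoint (nominal s) (d s) q := by
  obtain ⟨nom, δ, -, hU⟩ := h
  rcases hp with rfl | rfl
  · refine ⟨fun s => nom s, fun s => δ s / 2, fun s q hq => ?_⟩
    simp only [hU s, norm_toLp_one] at hq
    exact hq.isBasicPoint_l1
  · refine ⟨fun s => nom s, δ, fun s q hq => ?_⟩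
    have : Nonempty S := ⟨s⟩
    simp only [hU s, norm_toLp_top_le_iff] at hq
    exact hq.isBasicPoint_linfty

variable [DecidableEq S] {M : RMC S} {γ : ℝ} {τ : ℕ → S → stdSimplex ℝ S}

lemma IsPolicyIteration.isPolicy (h : M.IsPolicyIteration γ τ) (t : ℕ) : M.IsPolicy (τ t) := by
  cases t with
  | zero => exact h.1
  | succ t => exact fun s => (h.2 t s).1

lemma IsPolicyIteration.policyEval_le_succ (h : M.IsPolicyIteration γ τ) (h0 : 0 ≤ γ)
    (h1 : γ < 1) (t : ℕ) (s : S) : M.policyEval γ (τ t) s ≤ M.policyEval γ (τ (t + 1)) s :=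
  M.le_policyEval_of_subsolution h0 h1 (τ (t + 1)) (fun s =>
    (M.policyEval_apply h0 h1 (τ t) s).le.trans ((h.2 t s).2 _ (h.isPolicy t s))) s

variable {v : S → ℝ} {τopt : S → stdSimplex ℝ S}

/-- By monotonicity the new evaluation dominates one Bellman update of the old one, and that update
contracts the error. -/
lemma IsPolicyIteration.error_succ_le (h : M.IsPolicyIteration γ τ) (h0 : 0 ≤ γ) (h1 : γ < 1)
    (hv : M.IsBellmanSolution γ v τopt) {t : ℕ} {e : ℝ}
    (he : ∀ s, v s - M.policyEval γ (τ t) s ≤ e) (s : S) :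
    v s - M.policyEval γ (τ (t + 1)) s ≤ γ * e := by
  have e1 := hv.1 s
  have e2 := M.policyEval_apply h0 h1 (τ (t + 1)) s
  have e3 := mul_le_mul_of_nonneg_left
    (stdSimplex.sum_mul_le_sum_mul (τ (t + 1) s) (h.policyEval_le_succ h0 h1 t)) h0
  have e4 := (h.2 t s).2 _ (hv.2 s).1
  have e5 := mul_le_mul_of_nonneg_left (stdSimplex.sum_mul_le (q := τopt s) he) h0
  rw [stdSimplex.sum_mul_sub] at e5
  linarith

lemma IsPolicyIteration.error_add_le (h : M.IsPolicyIteration γ τ) (h0 : 0 ≤ γ) (h1 : γ < 1)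
    (hv : M.IsBellmanSolution γ v τopt) {t : ℕ} {e : ℝ}
    (he : ∀ s, v s - M.policyEval γ (τ t) s ≤ e) (k : ℕ) :
    ∀ s, v s - M.policyEval γ (τ (t + k)) s ≤ γ ^ k * e := by
  induction k with
  | zero => simpa using he
  | succ k ih =>
    intro s
    have := h.error_succ_le h0 h1 hv ih s
    rwa [pow_succ', mul_assoc]

/-- The measure of progress of policy iteration: `y t` is the regret, with respect to the optimal
value, of a vertex of some uncertainty set that is greedy for the value vector of iteration `t`. -/
lemma IsPolicyIteration.exists_regret [Nonempty S] (h : M.IsPolicyIteration γ τ) (h0 : 0 ≤ γ)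
    (h1 : γ < 1) (hv : M.IsBellmanSolution γ v τopt) (t : ℕ) :
    ∃ y : ℝ, 0 ≤ y ∧
      (∃ s w, IsVertexOf (M.uncertainty s) w ∧
        y = ∑ s', τopt s s' * (γ * v s') - ∑ s', w s' * (γ * v s')) ∧
      (∀ e, (∀ s, v s - M.policyEval γ (τ t) s ≤ e) → y ≤ γ * e) ∧
      ∀ s, v s - M.policyEval γ (τ (t + 1)) s ≤ y / (1 - γ) := by
  have hlin : ∀ (q : stdSimplex ℝ S) (u : S → ℝ), ∑ s, q s * (γ * u s) = γ * ∑ s, q s * u s := by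
    intro q u
    rw [Finset.mul_sum]
    exact Finset.sum_congr rfl fun s _ => by ring
  -- With ties, `τ (t + 1) s` need not be a vertex. It is replaced by a greedy vertex of no smaller
  -- regret, so bounds on the vertex regret still control the actual policy.
  have hw : ∀ s, ∃ w, IsVertexOf (M.uncertainty s) w ∧
      ∑ s', τ (t + 1) s s' * (γ * M.policyEval γ (τ t) s') ≤
        ∑ s', w s' * (γ * M.policyEval γ (τ t) s') ∧
      ∑ s', w s' * (γ * v s') ≤ ∑ s', τ (t + 1) s s' * (γ * v s') := by
    intro s
    refine exists_isVertexOf_of_isMaxOn (M.isCompact s) _ _ (h.2 t s).1 fun r hr => ?_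
    rw [hlin, hlin]
    linarith [(h.2 t s).2 r hr]
  choose w hvert hgreedy hregret using hw
  obtain ⟨m, hm⟩ := Finite.exists_max fun s =>
    ∑ s', τopt s s' * (γ * v s') - ∑ s', w s s' * (γ * v s')
  refine ⟨_, ?_, ⟨m, w m, hvert m, rfl⟩, fun e he => ?_, fun s => ?_⟩
  · have := mul_le_mul_of_nonneg_left ((hv.2 m).2 _ (hvert m).1) h0
    rw [hlin, hlin]
    linarith
  · have e1 := (h.2 t m).2 _ (hv.2 m).1
    have e2 := hgreedy m
    have e3 := mul_le_mul_of_nonneg_left (stdSimplex.sum_mul_le_sum_mul (w m)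
      (hv.policyEval_le h0 h1 (h.isPolicy t))) h0
    have e4 := mul_le_mul_of_nonneg_left (stdSimplex.sum_mul_le (q := τopt m) he) h0
    rw [stdSimplex.sum_mul_sub] at e4
    rw [hlin, hlin] at e2 ⊢
    linarith
  -- The error is the one-step regret, at most `y`, plus the discounted average of itself.
  · refine le_div_of_le_add_discounted h0 h1 (τ (t + 1))
      (x := fun s => v s - M.policyEval γ (τ (t + 1)) s) (fun s => ?_) s
    rw [stdSimplex.sum_mul_sub]
    have e1 := hv.1 s
    have e2 := M.policyEval_apply h0 h1 (τ (t + 1)) s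
    have e3 := hregret s
    have e4 := hm s
    simp only [hlin] at e3 e4 ⊢
    linarith

/-- Policy iteration reaches the value vector after a number of iterations that is independent of
the costs and of the uncertainty sets. -/
lemma IsPolicyIteration.policyEval_eq_value (h : M.IsPolicyIteration γ τ) (h0 : 0 ≤ γ)
    (h1 : γ < 1) (hn : 2 ≤ Fintype.card S) {p : ℝ≥0∞} (hp : p = 1 ∨ p = ⊤)
    (hM : M.HasLpUncertainty p) {L : ℕ} (hL : 1 ≤ L) (hγ : 2 * γ ^ L ≤ 1 - γ) {t : ℕ}
    (ht : Fintype.card S * (16 * (Fintype.card S + 1) ^ 2 * Nat.clog 2 (Fintype.card S)) * L + 1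
      ≤ t) :
    M.policyEval γ (τ t) = M.value γ := by
  have : Nonempty S := Fintype.card_pos_iff.1 (by lia)
  obtain ⟨v, τopt, hv⟩ := M.exists_isBellmanSolution h0 h1
  obtain ⟨nom, d, hbasic⟩ := hM.isBasicPoint hp
  choose y hy0 hy hyle hyerr using h.exists_regret h0 h1 hv
  -- Regret to error costs `1 / (1 - γ)`, the next `L - 1` iterations gain `γ ^ (L - 1)`, and error
  -- to regret gains another `γ`: in total `γ ^ L / (1 - γ) ≤ 1 / 2`.
  have hhalf : ∀ j, 2 * y ((j + 1) * L) ≤ y (j * L) := by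
    intro j
    have e1 := h.error_add_le h0 h1 hv (hyerr (j * L)) (L - 1)
    have e2 := hyle ((j + 1) * L) _ (by
      rwa [show j * L + 1 + (L - 1) = (j + 1) * L by rw [add_mul, one_mul]; lia] at e1)
    have e3 : γ * (γ ^ (L - 1) * (y (j * L) / (1 - γ))) = γ ^ L * y (j * L) / (1 - γ) := by
      rw [← mul_assoc, ← pow_succ', Nat.sub_add_cancel hL, mul_div_assoc]
    rw [e3, le_div_iff₀ (by linarith)] at e2
    have e4 := mul_le_mul_of_nonneg_right hγ (hy0 (j * L))
    have e5 : (1 - γ) * (2 * y ((j + 1) * L)) ≤ (1 - γ) * y (j * L) := by linarith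
    exact le_of_mul_le_mul_left e5 (by linarith)
  obtain ⟨j, hj, hj0⟩ := exists_nonpos_of_halving hn (z := fun j => y (j * L)) hhalf
    (fun s => basicTerms (nom s) (d s) (∑ s', τopt s s' * (γ * v s')) fun s' => γ * v s')
    fun j => by
      obtain ⟨s, w, hw, hyw⟩ := hy (j * L)
      obtain ⟨a, ha, hsum⟩ := (hbasic s w hw).exists_coeff
        (∑ s', τopt s s' * (γ * v s')) fun s' => γ * v s'
      exact ⟨s, a, ha, hyw.trans hsum⟩
  have hjt : j * L + 1 ≤ t := le_trans (by gcongr) ht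
  have herr : ∀ s, v s - M.policyEval γ (τ (j * L + 1)) s ≤ 0 := fun s =>
    (hyerr (j * L) s).trans (div_nonpos_of_nonpos_of_nonneg hj0 (by linarith))
  have hfin := h.error_add_le h0 h1 hv herr (t - (j * L + 1))
  rw [Nat.add_sub_cancel' hjt] at hfin
  rw [hv.eq_value h0 h1]
  refine funext fun s => le_antisymm (hv.policyEval_le h0 h1 (h.isPolicy t) s) ?_
  have := hfin s
  rw [mul_zero] at this
  linarith

end RMC

/-! ### Numerical bounds and the main theorem -/

lemma two_mul_pow_ceil_le {γ : ℝ} (h0 : 0 ≤ γ) (h1 : γ < 1) {n : ℕ} (hn : 2 ≤ n) :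
    2 * γ ^ ⌈max 1 (Real.log ((1 - γ) / n) / Real.log γ)⌉₊ ≤ 1 - γ := by
  set L := ⌈max 1 (Real.log ((1 - γ) / n) / Real.log γ)⌉₊ with hL
  have hle : max 1 (Real.log ((1 - γ) / n) / Real.log γ) ≤ L := Nat.le_ceil _
  have hL1 : L ≠ 0 := by
    rintro h
    rw [h] at hle
    have := (le_max_left _ _).trans hle
    norm_num at this
  have hn2 : (2 : ℝ) ≤ n := by exact_mod_cast hn
  rcases h0.eq_or_lt with rfl | hpos
  -- For `γ = 0` the quotient is 0 since `Real.log 0 = 0`; the maximum with 1 still gives a positive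
  -- exponent.
  · simp [hL1]
  have hlog : Real.log γ < 0 := Real.log_neg hpos h1
  have hQ : (L : ℝ) * Real.log γ ≤ Real.log ((1 - γ) / n) :=
    (div_le_iff_of_neg hlog).1 ((le_max_right _ _).trans hle)
  rw [← Real.log_pow, Real.log_le_log_iff (by positivity)
    (div_pos (by linarith) (by linarith)), le_div_iff₀ (by linarith)] at hQ
  nlinarith [pow_pos hpos L]

lemma clog_two_le_three_mul_log {n : ℕ} (hn : 2 ≤ n) :
    (Nat.clog 2 n : ℝ) ≤ 3 * Real.log n := by
  have hlt := Nat.pow_pred_clog_lt_self (b := 2) (by norm_num) (x := n) (by lia)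
  have hn2 : (2 : ℝ) ≤ n := by exact_mod_cast hn
  have hk : 1 ≤ Nat.clog 2 n := Nat.clog_pos (by norm_num) hn
  have h1 : ((2 : ℝ) ^ (Nat.clog 2 n - 1)) ≤ n := by exact_mod_cast hlt.le
  have h2 := Real.log_le_log (by positivity) h1
  rw [Real.log_pow, Nat.cast_sub hk, Nat.cast_one] at h2
  have h3 := Real.log_le_log (by norm_num) hn2
  have h4 := Real.log_two_gt_d9
  nlinarith

/-- The main term costs `16 * 4 * 3 * 2 = 384` and the additive 3 at most one more unit, so 400
suffices. -/
lemma iterations_add_three_le {γ : ℝ} {n : ℕ} (hn : 2 ≤ n) :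
    ((n * (16 * (n + 1) ^ 2 * Nat.clog 2 n) *
        ⌈max 1 (Real.log ((1 - γ) / n) / Real.log γ)⌉₊ + 3 : ℕ) : ℝ) ≤
      400 * ((n : ℝ) ^ 3 * Real.log n * max 1 (Real.log ((1 - γ) / n) / Real.log γ)) := by
  set Q := max 1 (Real.log ((1 - γ) / n) / Real.log γ) with hQ
  have hQ1 : 1 ≤ Q := le_max_left _ _
  have hL : (⌈Q⌉₊ : ℝ) ≤ 2 * Q := by linarith [Nat.ceil_lt_add_one (by linarith : 0 ≤ Q)]
  have hk := clog_two_le_three_mul_log hn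
  have hn2 : (2 : ℝ) ≤ n := by exact_mod_cast hn
  have hlog : 0.69 ≤ Real.log n := by
    linarith [Real.log_le_log (by norm_num) hn2, Real.log_two_gt_d9]
  have hn1 : (n : ℝ) + 1 ≤ 2 * n := by linarith
  push_cast
  have h1 : (n : ℝ) * (16 * ((n : ℝ) + 1) ^ 2 * Nat.clog 2 n) * ⌈Q⌉₊ ≤
      n * (16 * (2 * n) ^ 2 * (3 * Real.log n)) * (2 * Q) := by gcongr
  have h2 : (3 : ℝ) ≤ 2 ^ 3 * 0.69 * 1 := by norm_num
  have h3 : (2 : ℝ) ^ 3 * 0.69 * 1 ≤ (n : ℝ) ^ 3 * Real.log n * Q := by gcongr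
  linarith

theorem theorem2 :
    ∃ C : ℝ, ∀ (S : Type) [Fintype S] [DecidableEq S] (M : RMC S) (p : ENNReal) (γ : ℝ),
      2 ≤ Fintype.card S → p = 1 ∨ p = ⊤ → M.HasLpUncertainty p → 0 ≤ γ → γ < 1 →
      ∀ (N : ℝ), N = C * ((Fintype.card S : ℝ) ^ 3 * Real.log (Fintype.card S) *
          max 1 (Real.log ((1 - γ) / Fintype.card S) / Real.log γ)) →
      ∀ τ : ℕ → S → stdSimplex ℝ S, M.IsPolicyIteration γ τ →
        -- the stopping test succeeds after at most `N` iterations, at an optimal policy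
        (M.ConsistentTies γ τ → ∃ T : ℕ, RMC.StopsAt τ T ∧ (T : ℝ) ≤ N ∧
          M.IsOptimal γ (τ T) ∧ M.policyEval γ (τ T) = M.value γ) ∧
        -- however ties are broken, all policies from iteration `N` on are optimal
        (∀ t : ℕ, N ≤ t → M.IsOptimal γ (τ t) ∧ M.policyEval γ (τ t) = M.value γ) ∧
        -- each iteration amounts to solving two robust Markov chains of the same kind
        (∀ t : ℕ,
          (RMC.ofChain M.cost (τ t)).HasLpUncertainty p ∧
          (RMC.ofChain M.cost (τ t)).value γ = M.policyEval γ (τ t) ∧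
          (M.batch γ (M.policyEval γ (τ t))).HasLpUncertainty p ∧
          ∀ τ' : S → stdSimplex ℝ S, M.IsImprovement γ (M.policyEval γ (τ t)) τ' ↔
            ∃ σ, (M.batch γ (M.policyEval γ (τ t))).IsOptimal γ σ ∧
              ∀ s, σ (Sum.inl s) = stdSimplex.map Sum.inr (τ' s)) := by
  refine ⟨400, ?_⟩
  intro S _ _ M p γ hn hp hM h0 h1 N hN τ hτ
  have hbound := iterations_add_three_le (γ := γ) hn
  rw [← hN] at hbound
  have hconv := fun t => hτ.policyEval_eq_value h0 h1 hn hp hM (t := t)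
    (Nat.ceil_pos.2 (lt_of_lt_of_le one_pos (le_max_left _ _))) (two_mul_pow_ceil_le h0 h1 hn)
  set B := Fintype.card S * (16 * (Fintype.card S + 1) ^ 2 * Nat.clog 2 (Fintype.card S)) *
    ⌈max 1 (Real.log ((1 - γ) / Fintype.card S) / Real.log γ)⌉₊
  refine ⟨fun hties => ?_, fun t ht => ?_, fun t => ⟨RMC.ofChain_hasLpUncertainty _ _ hp,
    M.value_ofChain h0 h1 _, M.batch_hasLpUncertainty _ hp hM,
    M.isImprovement_iff_batch _ h0 h1⟩⟩
  · classical
    -- The evaluations at `B + 1` and `B + 2` are both the value, so consistent ties repeat the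
    -- policy at `B + 3`.
    have hrepeat : 1 ≤ B + 3 ∧ τ (B + 3) = τ (B + 3 - 1) :=
      ⟨by lia, hties (B + 1) ((hconv (B + 2) (by lia)).trans (hconv (B + 1) le_rfl).symm)⟩
    have hex : ∃ t, 1 ≤ t ∧ τ t = τ (t - 1) := ⟨_, hrepeat⟩
    obtain ⟨hT1, hT⟩ := Nat.find_spec hex
    have hle : Nat.find hex ≤ B + 3 := Nat.find_min' hex hrepeat
    have hleast : RMC.StopsAt τ (Nat.find hex) :=
      ⟨Nat.find_spec hex, fun t ht => Nat.find_min' hex ht⟩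
    -- The stopping time may precede convergence of the bound; optimality comes from the repeated
    -- policy being greedy for itself.
    have himp := hτ.2 (Nat.find hex - 1)
    rw [Nat.sub_add_cancel hT1, ← hT] at himp
    have hval := M.policyEval_eq_value_of_isImprovement h0 h1 himp
    exact ⟨_, hleast, (Nat.cast_le.2 hle).trans hbound,
      (M.isOptimal_iff_policyEval_eq h0 h1).2 ⟨hτ.isPolicy _, hval⟩, hval⟩
  · have hBt : B + 3 ≤ t := by exact_mod_cast hbound.trans ht
    have hval := hconv t (by lia)
    exact ⟨(M.isOptimal_iff_policyEval_eq h0 h1).2 ⟨hτ.isPolicy _, hval⟩, hval⟩
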